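/- Let $p\ge 1$, $c\in[0,1]$, $\omega=(\omega_1,\dots,\omega_p)$ with all $\omega_k\ge 0$ and at least one $\omega_k>0$, and $\mu=(\mu_1,\dots,\mu_p)\in\mathbb R^p$. Under $\mathbf P_\mu$ let $X_{k,\ell}$ ($1\le k\le p$, $\ell\ge 1$) be independent with $X_{k,\ell}\sim N(\mu_k,1)$, and let $f_a$ denote the density of $N(a,1)$. Put $\hat\mu_{k,1}=0$ and, for $\ell\ge 2$, $$\hat\mu_{k,\ell}=\omega_k+c\Big(\frac{X_{k,1}+\dots+X_{k,\ell-1}}{\ell-1}-\omega_k\Big),$$ and define $$\Lambda_n=\prod_{\ell=1}^n\prod_{k=1}^p\frac{f_{\hat\mu_{k,\ell}}(X_{k,\ell})}{f_0(X_{k,\ell})},\qquad \tau_b=\inf\{n\ge 1:\Lambda_n\ge e^b\}$$ (with $\inf\emptyset=\infty$). Let $\mu^*_k=\omega_k+c(\mu_k-\omega_k)$ and $$I=I(\mu^*,0;\mu)=\mathbf E_\mu\sum_{k=1}^p\log\frac{f_{\mu^*_k}(X_{k,1})}{f_0(X_{k,1})}=\tfrac12\big[\|\mu\|^2-(1-c)^2\|\mu-\omega\|^2\big].$$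 If $I>0$, then $\mathbf E_\mu(\tau_b)<\infty$ for every real $b$ and, for fixed $p,c,\omega,\mu$, as $b\to\infty$, $$\mathbf E_\mu(\tau_b)=\frac{b+(pc^2/2)\log b-(pc^2/2)\log I}{I}+o(p\log b).$$ -/

import Mathlib

open MeasureTheory ProbabilityTheory Filter Asymptotics
open scoped ENNReal BigOperators

noncomputable section

/-- The linear shrinkage estimate at time `ℓ` of the mean of one stream `x 1, x 2, …`, with
shrinkage factor `c` and target `w`: it is `0` at time `ℓ = 1`, and for `ℓ ≥ 2` it is
`w + c * (mean of x 1, …, x (ℓ - 1) - w)`. The entry `x 0` is never used. -/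
def shrinkEst (c w : ℝ) (x : ℕ → ℝ) (ℓ : ℕ) : ℝ :=
  if ℓ ≤ 1 then 0
  else w + c * ((∑ i ∈ Finset.Icc 1 (ℓ - 1), x i) / ((ℓ : ℝ) - 1) - w)

/-- The plug-in likelihood ratio `Λ_n` of `N(estimate, 1)` against `N(0, 1)`, computed from the
observations `x k ℓ` of stream `k` at times `ℓ = 1, …, n`. -/
def plugInLR {p : ℕ} (c : ℝ) (w : Fin p → ℝ) (x : Fin p → ℕ → ℝ) (n : ℕ) : ℝ :=
  ∏ ℓ ∈ Finset.Icc 1 n, ∏ k : Fin p,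
    gaussianPDFReal (shrinkEst c (w k) (x k) ℓ) 1 (x k ℓ) / gaussianPDFReal 0 1 (x k ℓ)

/-- The stopping time `τ_b = inf {n ≥ 1 : Λ_n ≥ exp b}`, equal to `⊤` if there is no such `n`. -/
def stopTime {p : ℕ} (c : ℝ) (w : Fin p → ℝ) (b : ℝ) (x : Fin p → ℕ → ℝ) : ℕ∞ :=
  ⨅ (n : ℕ) (_ : 1 ≤ n ∧ Real.exp b ≤ plugInLR c w x n), (n : ℕ∞)

/-- The vector `μ*` with entries `ω_k + c (μ_k - ω_k)`. -/
def shrunkMean {p : ℕ} (c : ℝ) (w μ : Fin p → ℝ) : Fin p → ℝ :=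
  fun k => w k + c * (μ k - w k)

/-- The information number `I(ψ, φ; μ) = E_μ ∑_k log (f_{ψ_k}(X_k) / f_{φ_k}(X_k))`, where the
`X_k` are independent with law `N(μ_k, 1)` and `f_a` is the density of `N(a, 1)`. -/
def infoNumber {p : ℕ} (ψ φ μ : Fin p → ℝ) : ℝ :=
  ∫ x : Fin p → ℝ,
    ∑ k, Real.log (gaussianPDFReal (ψ k) 1 (x k) / gaussianPDFReal (φ k) 1 (x k))
    ∂(Measure.pi fun k => gaussianReal (μ k) 1)

theorem log_gaussianPDFReal_div (a b y : ℝ) :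
    Real.log (gaussianPDFReal a 1 y / gaussianPDFReal b 1 y)
      = (a - b) * y - (a ^ 2 - b ^ 2) / 2 := by
  have h : gaussianPDFReal a 1 y / gaussianPDFReal b 1 y
      = Real.exp ((a - b) * y - (a ^ 2 - b ^ 2) / 2) := by
    rw [div_eq_iff (gaussianPDFReal_pos b 1 y one_ne_zero).ne']
    simp only [gaussianPDFReal]
    rw [mul_left_comm, ← Real.exp_add]
    congr 2
    push_cast
    ring
  rw [h, Real.log_exp]

/-- The closed form of the information number at `(μ*, 0)`. -/
theorem infoNumber_shrunkMean_zero {p : ℕ} (c : ℝ) (w μ : Fin p → ℝ) :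
    infoNumber (shrunkMean c w μ) 0 μ
      = (1 / 2) * (∑ k, μ k ^ 2 - (1 - c) ^ 2 * ∑ k, (μ k - w k) ^ 2) := by
  have hint : ∀ k : Fin p, Integrable (fun x : Fin p → ℝ => x k)
      (Measure.pi fun k => gaussianReal (μ k) 1) := fun k =>
    integrable_comp_eval (μ := fun k => gaussianReal (μ k) 1) (i := k) (f := fun y : ℝ => y)
      ((memLp_id_gaussianReal 1).integrable le_rfl)
  have hval : ∀ k : Fin p, ∫ x : Fin p → ℝ, x k ∂(Measure.pi fun k => gaussianReal (μ k) 1)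
      = μ k := fun k => by
    rw [integral_comp_eval (μ := fun k => gaussianReal (μ k) 1) (i := k) (f := fun y : ℝ => y)
      aestronglyMeasurable_id]
    exact integral_id_gaussianReal
  unfold infoNumber
  simp only [log_gaussianPDFReal_div]
  have hsub : ∀ (k : Fin p) (a d : ℝ), Integrable (fun x : Fin p → ℝ => a * x k - d)
      (Measure.pi fun k => gaussianReal (μ k) 1) := fun k a d =>
    ((hint k).const_mul a).sub (integrable_const d)
  rw [integral_finsetSum _ fun k _ => hsub k _ _, Finset.mul_sum, ← Finset.sum_sub_distrib, Finset.mul_sum]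
  refine Finset.sum_congr rfl fun k _ => ?_
  rw [integral_sub ((hint k).const_mul _) (integrable_const _), integral_const_mul, hval]
  simp only [shrunkMean, Pi.zero_apply, integral_const, probReal_univ, one_smul]
  ring

end

/-!
Up to its first step, `log Λ_n` is a random walk with drift `I` plus a martingale, minus the
accumulated losses `R i = O(i ^ (-1 / 2))` caused by estimating `μ*`, with means `(p c² / 2) / i`.
Stop it on passing the level `b`, at the latest at time `2 N` with `N = ⌈b / I⌉`. Optional stopping
gives `I * E τ = b + (mean loss up to τ) + (mean overshoot) + O(1)`. The overshoot is at most the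
largest of `2 N` increments, whose mean is `o(log b)` because Gaussian variables have exponential
moments of every order. Replacing the mean loss up to `τ` by that up to `N` costs
`η log b + O(1)` for every `η > 0`: the losses at distance `d` from `N` are estimated by AM-GM with
weight `N / (d + 1)`, which leaves `E (τ - N)² / N = O(1)` and a sum of order `log N`. A fourth
moment bound controls the time spent below level `b` after `2 N`, and the harmonic sum of the mean
losses up to `N` is `(p c² / 2) log (b / I) + O(1)`.
-/

theorem sum_inv_succ_le (m : ℕ) : ∑ i ∈ Finset.range m, ((i : ℝ) + 1)⁻¹ ≤ 1 + Real.log m := by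
  simpa [harmonic] using harmonic_le_one_add_log m

theorem sum_inv_sqrt_succ_le (m : ℕ) :
    ∑ i ∈ Finset.range m, (√((i : ℝ) + 1))⁻¹ ≤ 2 * √(m : ℝ) := by
  induction m with
  | zero => simp
  | succ m ih =>
    have hpos : 0 < √((m : ℝ) + 1) := Real.sqrt_pos.2 (by positivity)
    have hsucc : √((m : ℝ) + 1) ^ 2 = m + 1 := Real.sq_sqrt (by positivity)
    have hm : √(m : ℝ) ^ 2 = m := Real.sq_sqrt (by positivity)
    have hstep : (√((m : ℝ) + 1))⁻¹ ≤ 2 * √((m : ℝ) + 1) - 2 * √(m : ℝ) := by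
      rw [inv_le_iff_one_le_mul₀' hpos]
      nlinarith [sq_nonneg (√((m : ℝ) + 1) - √(m : ℝ))]
    rw [Finset.sum_range_succ]
    push_cast
    linarith

theorem sum_inv_abs_sub_add_one_le (N : ℕ) :
    ∑ i ∈ Finset.range (N + N), (|(i : ℝ) - N| + 1)⁻¹ ≤ 2 * (1 + Real.log N) := by
  rw [Finset.sum_range_add, two_mul, ← Finset.sum_range_reflect]
  refine add_le_add (le_trans (Finset.sum_le_sum fun i hi => inv_anti₀ (by positivity) ?_)
    (sum_inv_succ_le N)) ((Finset.sum_congr rfl fun i _ => ?_).trans_le (sum_inv_succ_le N))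
  · have hcast : ((N - 1 - i : ℕ) : ℝ) = N - 1 - i := by
      rw [Finset.mem_range] at hi
      rw [Nat.sub_sub, Nat.cast_sub (by omega)]
      push_cast
      ring
    rw [hcast]
    linarith [neg_abs_le ((N : ℝ) - 1 - i - N)]
  · push_cast
    rw [add_sub_cancel_left, abs_of_nonneg (by positivity)]

theorem sum_weight_mul_inv_succ_le (N : ℕ) :
    ∑ i ∈ Finset.range (N + N), (N : ℝ) / (|(i : ℝ) - N| + 1) * ((i : ℝ) + 1)⁻¹
      ≤ 3 * (1 + Real.log (N + N : ℕ)) := by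
  have hterm (i : ℕ) : (N : ℝ) / (|(i : ℝ) - N| + 1) * ((i : ℝ) + 1)⁻¹
      ≤ (|(i : ℝ) - N| + 1)⁻¹ + ((i : ℝ) + 1)⁻¹ := by
    rw [div_mul_eq_mul_div, div_le_iff₀ (by positivity), add_mul, inv_mul_cancel₀ (by positivity),
      ← sub_nonneg]
    have hN : (N : ℝ) ≤ i + 1 + (|(i : ℝ) - N| + 1) := by linarith [neg_abs_le ((i : ℝ) - N)]
    have hi : ((i : ℝ) + 1)⁻¹ * (i + 1) = 1 := inv_mul_cancel₀ (by positivity)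
    have hinv : 0 ≤ ((i : ℝ) + 1)⁻¹ := by positivity
    nlinarith [mul_le_mul_of_nonneg_left hN hinv]
  have hlog : Real.log N ≤ Real.log (N + N : ℕ) := by
    rcases N.eq_zero_or_pos with rfl | hN
    · simp
    · exact Real.log_le_log (by exact_mod_cast hN) (by exact_mod_cast N.le_add_right N)
  calc _ ≤ ∑ i ∈ Finset.range (N + N), ((|(i : ℝ) - N| + 1)⁻¹ + ((i : ℝ) + 1)⁻¹) :=
        Finset.sum_le_sum fun i _ => hterm i
    _ ≤ 2 * (1 + Real.log N) + (1 + Real.log (N + N : ℕ)) := by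
        rw [Finset.sum_add_distrib]
        exact add_le_add (sum_inv_abs_sub_add_one_le N) (sum_inv_succ_le _)
    _ ≤ _ := by linarith

theorem abs_sum_range_sub_sum_range_le (r : ℕ → ℝ) (T N : ℕ) :
    |∑ i ∈ Finset.range T, r i - ∑ i ∈ Finset.range N, r i|
      ≤ ∑ i ∈ Finset.Ico (min T N) (max T N), |r i| := by
  wlog h : N ≤ T generalizing T N
  · rw [abs_sub_comm, min_comm, max_comm]
    exact this N T (by omega)
  rw [min_eq_right h, max_eq_left h, ← Finset.sum_Ico_eq_sub _ h]
  exact Finset.abs_sum_le_sum_abs _ _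

theorem card_Ico_min_max (T N : ℕ) :
    ((Finset.Ico (min T N) (max T N)).card : ℝ) = |(T : ℝ) - N| := by
  have hz : ((Finset.Ico (min T N) (max T N)).card : ℤ) = |(T : ℤ) - N| := by
    rw [Nat.card_Ico]; grind
  simpa using congrArg (Int.cast (R := ℝ)) hz

theorem abs_sub_le_of_mem_Ico_min_max {T N i : ℕ} (hi : i ∈ Finset.Ico (min T N) (max T N)) :
    |(i : ℝ) - N| ≤ |(T : ℝ) - N| := by
  have hz : |(i : ℤ) - N| ≤ |(T : ℤ) - N| := by grind
  simpa using (Int.cast_le (R := ℝ)).2 hz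

theorem le_weighted_sq_add_inv {x a η : ℝ} (ha : 0 < a) (hη : 0 < η) :
    x ≤ η * (a * x ^ 2) + a⁻¹ / (4 * η) := by
  have h : η * (a * x ^ 2) + a⁻¹ / (4 * η) - x = (2 * η * a * x - 1) ^ 2 / (4 * η * a) := by
    field_simp
    ring
  rw [← sub_nonneg, h]
  positivity

theorem abs_sum_range_sub_sum_range_le_weighted (r : ℕ → ℝ) {T N m : ℕ} (hT : T ≤ m) (hN : N ≤ m)
    (hN0 : 0 < N) {η : ℝ} (hη : 0 < η) :
    |∑ i ∈ Finset.range T, r i - ∑ i ∈ Finset.range N, r i|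
      ≤ η * ∑ i ∈ Finset.range m, (N : ℝ) / (|(i : ℝ) - N| + 1) * r i ^ 2
        + ((T : ℝ) - N) ^ 2 / (2 * η * N) := by
  have : (0 : ℝ) < N := by exact_mod_cast hN0
  set d : ℝ := |(T : ℝ) - N| with hd
  have hd_sq : d ≤ d ^ 2 := by
    rw [hd, ← card_Ico_min_max]; exact_mod_cast Nat.le_self_pow two_ne_zero _
  have hterm {i : ℕ} (hi : i ∈ Finset.Ico (min T N) (max T N)) :
      |r i| ≤ η * (N / (|(i : ℝ) - N| + 1) * r i ^ 2) + (d + 1) / N / (4 * η) := by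
    rw [← sq_abs (r i)]
    refine (le_weighted_sq_add_inv (a := N / (|(i : ℝ) - N| + 1)) (by positivity) hη).trans ?_
    rw [inv_div]
    gcongr
    exact abs_sub_le_of_mem_Ico_min_max hi
  calc _ ≤ ∑ i ∈ Finset.Ico (min T N) (max T N), |r i| := abs_sum_range_sub_sum_range_le r T N
    _ ≤ ∑ i ∈ Finset.Ico (min T N) (max T N),
          (η * (N / (|(i : ℝ) - N| + 1) * r i ^ 2) + (d + 1) / N / (4 * η)) :=
        Finset.sum_le_sum fun i hi => hterm hi
    _ = η * ∑ i ∈ Finset.Ico (min T N) (max T N), N / (|(i : ℝ) - N| + 1) * r i ^ 2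
          + d * ((d + 1) / N / (4 * η)) := by
        rw [Finset.sum_add_distrib, ← Finset.mul_sum, Finset.sum_const, nsmul_eq_mul,
          card_Ico_min_max]
    _ ≤ η * ∑ i ∈ Finset.range m, N / (|(i : ℝ) - N| + 1) * r i ^ 2
          + d * ((d + 1) / N / (4 * η)) := by
        gcongr
        intro i hi
        rw [Finset.mem_Ico] at hi
        rw [Finset.mem_range]
        omega
    _ ≤ _ := by
        rw [← sq_abs ((T : ℝ) - N), ← hd, add_le_add_iff_left, div_div, ← mul_div_assoc,
          div_le_div_iff₀ (by positivity) (by positivity)]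
        have : 0 ≤ η * N := by positivity
        nlinarith

theorem sub_sq_div_le_min {b x S : ℝ} (hb : 0 < b) (hbx : 2 * b ≤ x) :
    b - (S - x) ^ 2 / (2 * x) ≤ min b S := by
  have hx : 0 < 2 * x := by linarith
  refine le_min (sub_le_self b (by positivity)) ?_
  rw [sub_le_iff_le_add, ← sub_le_iff_le_add', le_div_iff₀ hx]
  nlinarith [sq_nonneg S]

theorem add_pow_four_le {x y n : ℝ} (hn : 0 < n) :
    (x + y) ^ 4 ≤ (1 + n⁻¹) * x ^ 4 + 4 * (x ^ 3 * y) + (16 * n + 3) * y ^ 4 := by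
  have h : (1 + n⁻¹) * x ^ 4 + 4 * (x ^ 3 * y) + (16 * n + 3) * y ^ 4 - (x + y) ^ 4
      = (x ^ 2 - 4 * n * y ^ 2) ^ 2 / n + 2 * (y * (x - y)) ^ 2 := by
    field_simp
    ring
  rw [← sub_nonneg, h]
  positivity

theorem sub_sub_pow_four_le (x y z : ℝ) :
    (x - y - z) ^ 4 ≤ 27 * (x ^ 4 + y ^ 4 + z ^ 4) := by
  have hsq : (x - y - z) ^ 2 ≤ 3 * (x ^ 2 + y ^ 2 + z ^ 2) := by
    nlinarith [sq_nonneg (x + y), sq_nonneg (x + z), sq_nonneg (y - z)]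
  calc (x - y - z) ^ 4 = ((x - y - z) ^ 2) ^ 2 := by ring
    _ ≤ (3 * (x ^ 2 + y ^ 2 + z ^ 2)) ^ 2 := by gcongr
    _ ≤ 27 * (x ^ 4 + y ^ 4 + z ^ 4) := by
      nlinarith [sq_nonneg (x ^ 2 - y ^ 2), sq_nonneg (x ^ 2 - z ^ 2), sq_nonneg (y ^ 2 - z ^ 2)]

theorem abs_ite_eq_zero_le (a : ℝ) (i : ℕ) : |if i = 0 then 0 else a| ≤ |a| := by
  split_ifs <;> simp

section Moments

variable {Ω : Type*} [MeasurableSpace Ω] {P : Measure Ω}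

theorem holderTriple_two_mul (q : NNReal) :
    ENNReal.HolderTriple ↑(2 * q) ↑(2 * q) (q : ℝ≥0∞) where
  inv_add_inv_eq_inv := by
    push_cast
    rw [ENNReal.mul_inv (.inl two_ne_zero) (.inl ENNReal.ofNat_ne_top), ← add_mul,
      ENNReal.inv_two_add_inv_two, one_mul]

/-- The real function `f` has finite absolute moments of all orders. This class is closed under
products, so it makes integrability of polynomial expressions automatic. -/
@[fun_prop]
def HasAllMoments (f : Ω → ℝ) (P : Measure Ω) : Prop :=
  ∀ q : NNReal, MemLp f q P

namespace HasAllMoments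

variable {f g : Ω → ℝ}

@[fun_prop]
theorem const [IsFiniteMeasure P] (a : ℝ) : HasAllMoments (fun _ => a) P := fun _ => memLp_const a

@[fun_prop]
theorem add (hf : HasAllMoments f P) (hg : HasAllMoments g P) :
    HasAllMoments (fun s => f s + g s) P :=
  fun q => (hf q).add (hg q)

@[fun_prop]
theorem sub (hf : HasAllMoments f P) (hg : HasAllMoments g P) :
    HasAllMoments (fun s => f s - g s) P :=
  fun q => (hf q).sub (hg q)

@[fun_prop]
theorem mul (hf : HasAllMoments f P) (hg : HasAllMoments g P) :
    HasAllMoments (fun s => f s * g s) P := fun q => by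
  have := holderTriple_two_mul q
  exact (hg (2 * q)).mul' (hf (2 * q))

@[fun_prop]
theorem div_const [IsFiniteMeasure P] (hf : HasAllMoments f P) (a : ℝ) :
    HasAllMoments (fun s => f s / a) P := by
  simpa only [div_eq_mul_inv] using hf.mul (const a⁻¹)

@[fun_prop]
theorem pow [IsFiniteMeasure P] (hf : HasAllMoments f P) (n : ℕ) :
    HasAllMoments (fun s => f s ^ n) P := by
  induction n with
  | zero => simpa using HasAllMoments.const (P := P) 1
  | succ n ih => simpa only [pow_succ] using ih.mul hf

@[fun_prop]
theorem abs (hf : HasAllMoments f P) : HasAllMoments (fun s => |f s|) P := fun q => (hf q).abs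

@[fun_prop]
theorem sum {ι : Type*} (t : Finset ι) {f : ι → Ω → ℝ} (hf : ∀ i ∈ t, HasAllMoments (f i) P) :
    HasAllMoments (fun s => ∑ i ∈ t, f i s) P :=
  fun q => memLp_finsetSum t fun i hi => hf i hi q

theorem indicator {A : Set Ω} (hA : MeasurableSet A) (hf : HasAllMoments f P) :
    HasAllMoments (A.indicator f) P :=
  fun q => (hf q).indicator hA

@[fun_prop]
theorem aestronglyMeasurable (hf : HasAllMoments f P) : AEStronglyMeasurable f P := (hf 1).1

theorem integrable (hf : HasAllMoments f P) : Integrable f P :=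
  memLp_one_iff_integrable.1 (by simpa using hf 1)

end HasAllMoments

theorem lpNorm_pow_eq_integral_pow {f : Ω → ℝ} (hf : AEStronglyMeasurable f P) {n : ℕ} (hn : Even n)
    (hn0 : n ≠ 0) : lpNorm f (n : NNReal) P ^ n = ∫ s, f s ^ n ∂P := by
  rw [lpNorm_nnreal_eq_integral_norm_rpow (by exact_mod_cast hn0) hf, NNReal.coe_natCast,
    Real.rpow_inv_natCast_pow (integral_nonneg fun s => by positivity) hn0]
  simp only [Real.rpow_natCast, Real.norm_eq_abs, hn.pow_abs]

theorem HasAllMoments.lpNorm_mul_le {f g : Ω → ℝ} (hf : HasAllMoments f P) (hg : HasAllMoments g P)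
    (q : NNReal) : lpNorm (fun s => f s * g s) q P
      ≤ lpNorm f ↑(2 * q) P * lpNorm g ↑(2 * q) P := by
  have := holderTriple_two_mul q
  have hle : eLpNorm (f • g) q P ≤ eLpNorm f ↑(2 * q) P * eLpNorm g ↑(2 * q) P :=
    eLpNorm_smul_le_mul_eLpNorm hg.aestronglyMeasurable hf.aestronglyMeasurable
  rw [← toReal_eLpNorm (hf.mul hg).aestronglyMeasurable,
    ← toReal_eLpNorm hf.aestronglyMeasurable, ← toReal_eLpNorm hg.aestronglyMeasurable,
    ← ENNReal.toReal_mul]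
  exact ENNReal.toReal_mono
    (ENNReal.mul_ne_top (hf (2 * q)).eLpNorm_ne_top (hg (2 * q)).eLpNorm_ne_top) hle

/-- The family `f` of random variables is `O(r)` in every `Lᵠ` with finite `q`; the implied constant
may depend on `q`. -/
structure IsLpBigO {ι : Type*} (f : ι → Ω → ℝ) (r : ι → ℝ) (P : Measure Ω) : Prop where
  hasAllMoments : ∀ i, HasAllMoments (f i) P
  exists_lpNorm_le : ∀ q : NNReal, 1 ≤ q → ∃ C, ∀ i, lpNorm (f i) q P ≤ C * r i

namespace IsLpBigO

variable {ι : Type*} {f g : ι → Ω → ℝ} {r r' : ι → ℝ}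

theorem mono (hf : IsLpBigO f r P) (h0 : ∀ i, 0 ≤ r i) {A : ℝ} (h : ∀ i, r i ≤ A * r' i) :
    IsLpBigO f r' P where
  hasAllMoments := hf.hasAllMoments
  exists_lpNorm_le q hq := by
    obtain ⟨C, hC⟩ := hf.exists_lpNorm_le q hq
    refine ⟨|C| * A, fun i => (hC i).trans ?_⟩
    rw [mul_assoc]
    exact mul_le_mul (le_abs_self C) (h i) (h0 i) (abs_nonneg C)

theorem of_abs_le [IsProbabilityMeasure P] {a : ι → ℝ} {A : ℝ} (ha : ∀ i, |a i| ≤ A) :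
    IsLpBigO (fun i (_ : Ω) => a i) 1 P where
  hasAllMoments i := .const (a i)
  exists_lpNorm_le q hq := ⟨A, fun i => by
    rw [lpNorm_const (by exact_mod_cast (zero_lt_one.trans_le hq).ne')
      (IsProbabilityMeasure.ne_zero P)]
    simpa using ha i⟩

theorem add (hf : IsLpBigO f r P) (hg : IsLpBigO g r P) :
    IsLpBigO (fun i s => f i s + g i s) r P where
  hasAllMoments i := (hf.hasAllMoments i).add (hg.hasAllMoments i)
  exists_lpNorm_le q hq := by
    obtain ⟨C, hC⟩ := hf.exists_lpNorm_le q hq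
    obtain ⟨D, hD⟩ := hg.exists_lpNorm_le q hq
    refine ⟨C + D, fun i => ?_⟩
    rw [add_mul]
    exact (lpNorm_add_le (hf.hasAllMoments i q) (by exact_mod_cast hq)).trans
      (add_le_add (hC i) (hD i))

theorem mul (hf : IsLpBigO f r P) (hg : IsLpBigO g r' P) :
    IsLpBigO (fun i s => f i s * g i s) (r * r') P where
  hasAllMoments i := (hf.hasAllMoments i).mul (hg.hasAllMoments i)
  exists_lpNorm_le q hq := by
    have hq2 : 1 ≤ 2 * q := hq.trans (le_mul_of_one_le_left' one_le_two)
    obtain ⟨C, hC⟩ := hf.exists_lpNorm_le (2 * q) hq2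
    obtain ⟨D, hD⟩ := hg.exists_lpNorm_le (2 * q) hq2
    refine ⟨C * D, fun i => ?_⟩
    rw [Pi.mul_apply, mul_mul_mul_comm]
    exact ((hf.hasAllMoments i).lpNorm_mul_le (hg.hasAllMoments i) q).trans
      (mul_le_mul (hC i) (hD i) lpNorm_nonneg (lpNorm_nonneg.trans (hC i)))

theorem const_mul [IsProbabilityMeasure P] (a : ℝ) (hf : IsLpBigO f r P) :
    IsLpBigO (fun i s => a * f i s) r P := by
  simpa using (of_abs_le (ι := ι) fun _ => le_refl |a|).mul hf

theorem sum {κ : Type*} (t : Finset κ) {f : κ → ι → Ω → ℝ} (hf : ∀ k ∈ t, IsLpBigO (f k) r P) :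
    IsLpBigO (fun i s => ∑ k ∈ t, f k i s) r P where
  hasAllMoments i := .sum t fun k hk => (hf k hk).hasAllMoments i
  exists_lpNorm_le q hq := by
    choose! C hC using fun k hk => (hf k hk).exists_lpNorm_le q hq
    refine ⟨∑ k ∈ t, C k, fun i => ?_⟩
    rw [Finset.sum_mul]
    refine le_trans ?_ (Finset.sum_le_sum fun k hk => hC k hk i)
    simpa only [Finset.sum_fn] using lpNorm_sum_le (fun k hk => (hf k hk).hasAllMoments i q)
      (by exact_mod_cast hq : (1 : ℝ≥0∞) ≤ q)

theorem abs (hf : IsLpBigO f r P) : IsLpBigO (fun i s => |f i s|) r P where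
  hasAllMoments i := (hf.hasAllMoments i).abs
  exists_lpNorm_le q hq := by
    simpa only [lpNorm_fun_abs (hf.hasAllMoments _).aestronglyMeasurable] using
      hf.exists_lpNorm_le q hq

theorem sum_range_of_inv_sqrt {f : ℕ → Ω → ℝ}
    (hf : IsLpBigO f (fun i => (√((i : ℝ) + 1))⁻¹) P) :
    IsLpBigO (fun n s => ∑ i ∈ Finset.range n, f i s) (fun n => √(n : ℝ)) P where
  hasAllMoments n := .sum _ fun i _ => hf.hasAllMoments i
  exists_lpNorm_le q hq := by
    obtain ⟨C, hC⟩ := hf.exists_lpNorm_le q hq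
    have hC0 : 0 ≤ C := by simpa using lpNorm_nonneg.trans (hC 0)
    refine ⟨2 * C, fun n => ?_⟩
    calc lpNorm (fun s => ∑ i ∈ Finset.range n, f i s) q P
        ≤ ∑ i ∈ Finset.range n, lpNorm (f i) q P := by
          simpa only [Finset.sum_fn] using lpNorm_sum_le (fun i _ => hf.hasAllMoments i q)
            (by exact_mod_cast hq : (1 : ℝ≥0∞) ≤ q)
      _ ≤ ∑ i ∈ Finset.range n, C * (√((i : ℝ) + 1))⁻¹ := Finset.sum_le_sum fun i _ => hC i
      _ ≤ 2 * C * √(n : ℝ) := by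
          rw [← Finset.mul_sum, mul_comm 2 C, mul_assoc]
          exact mul_le_mul_of_nonneg_left (sum_inv_sqrt_succ_le n) hC0

theorem exists_integral_pow_le (hf : IsLpBigO f r P) {n : ℕ} (hn : Even n) (hn0 : n ≠ 0) :
    ∃ C, ∀ i, ∫ s, f i s ^ n ∂P ≤ C * r i ^ n := by
  obtain ⟨C, hC⟩ := hf.exists_lpNorm_le n (by exact_mod_cast Nat.one_le_iff_ne_zero.2 hn0)
  refine ⟨C ^ n, fun i => ?_⟩
  rw [← lpNorm_pow_eq_integral_pow (hf.hasAllMoments i).aestronglyMeasurable hn hn0, ← mul_pow]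
  exact pow_le_pow_left₀ lpNorm_nonneg (hC i) n

end IsLpBigO

end Moments

section MartingaleDifference

variable {Ω : Type*} {mΩ : MeasurableSpace Ω} {P : Measure Ω} {F : Filtration ℕ mΩ}
  {D : ℕ → Ω → ℝ}

/-- `D` is a sequence of martingale differences with finite moments of all orders. The index is
shifted: `D i` is the increment from time `i` to time `i + 1`. -/
structure IsMartingaleDifference (D : ℕ → Ω → ℝ) (F : Filtration ℕ mΩ) (P : Measure Ω) :
    Prop where
  measurable (i : ℕ) : Measurable[F (i + 1)] (D i)
  hasAllMoments (i : ℕ) : HasAllMoments (D i) P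
  condExp_eq_zero (i : ℕ) : P[D i|F i] =ᵐ[P] 0

namespace IsMartingaleDifference

theorem measurable_sum_range (hD : IsMartingaleDifference D F P) (n : ℕ) :
    Measurable[F n] fun s => ∑ i ∈ Finset.range n, D i s :=
  Finset.measurable_fun_sum _ fun i hi =>
    (hD.measurable i).mono (F.mono (Finset.mem_range.1 hi)) le_rfl

theorem indicator (hD : IsMartingaleDifference D F P) {A : ℕ → Set Ω}
    (hA : ∀ i, MeasurableSet[F i] (A i)) :
    IsMartingaleDifference (fun i => (A i).indicator (D i)) F P where
  measurable i := (hD.measurable i).indicator (F.mono i.le_succ _ (hA i))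
  hasAllMoments i := (hD.hasAllMoments i).indicator (F.le i _ (hA i))
  condExp_eq_zero i := by
    refine (condExp_indicator (hD.hasAllMoments i).integrable (hA i)).trans ?_
    filter_upwards [hD.condExp_eq_zero i] with s hs
    simp [Set.indicator, hs]

theorem sum {κ : Type*} (t : Finset κ) {D : κ → ℕ → Ω → ℝ}
    (hD : ∀ k ∈ t, IsMartingaleDifference (D k) F P) :
    IsMartingaleDifference (fun i s => ∑ k ∈ t, D k i s) F P where
  measurable i := Finset.measurable_fun_sum _ fun k hk => (hD k hk).measurable i
  hasAllMoments i := .sum t fun k hk => (hD k hk).hasAllMoments i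
  condExp_eq_zero i := by
    have hsum : P[∑ k ∈ t, D k i|F i] =ᵐ[P] ∑ k ∈ t, P[D k i|F i] :=
      condExp_finsetSum (fun k hk => ((hD k hk).hasAllMoments i).integrable) (F i)
    have hzero : ∀ᵐ s ∂P, ∀ k ∈ t, (P[D k i|F i]) s = 0 :=
      (ae_ball_iff t.countable_toSet).2 fun k hk => (hD k hk).condExp_eq_zero i
    rw [← Finset.sum_fn]
    filter_upwards [hsum, hzero] with s hs hs0
    rw [hs, Finset.sum_apply, Finset.sum_eq_zero hs0, Pi.zero_apply]

theorem integral_mul_eq_zero [IsFiniteMeasure P] (hD : IsMartingaleDifference D F P) {i : ℕ}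
    {g : Ω → ℝ} (hg : Measurable[F i] g) (hg' : HasAllMoments g P) :
    ∫ s, g s * D i s ∂P = 0 := by
  have hpull : P[g * D i|F i] =ᵐ[P] g * P[D i|F i] :=
    condExp_mul_of_stronglyMeasurable_left hg.stronglyMeasurable
      (hg'.mul (hD.hasAllMoments i)).integrable (hD.hasAllMoments i).integrable
  have hzero : P[g * D i|F i] =ᵐ[P] 0 := by
    filter_upwards [hpull, hD.condExp_eq_zero i] with s hs hs0
    simp [hs, hs0]
  calc ∫ s, g s * D i s ∂P = ∫ s, (P[g * D i|F i]) s ∂P := (integral_condExp (F.le i)).symm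
    _ = 0 := by simp [integral_congr_ae hzero]

theorem integral_sum_range_eq_zero [IsFiniteMeasure P] (hD : IsMartingaleDifference D F P)
    (n : ℕ) : ∫ s, ∑ i ∈ Finset.range n, D i s ∂P = 0 := by
  rw [integral_finsetSum _ fun i _ => (hD.hasAllMoments i).integrable]
  refine Finset.sum_eq_zero fun i _ => ?_
  simpa using hD.integral_mul_eq_zero (g := fun _ => 1) measurable_const (.const 1)

theorem integral_sum_range_pow_four_le [IsFiniteMeasure P] (hD : IsMartingaleDifference D F P)
    {K : ℝ} (hK : ∀ i, ∫ s, D i s ^ 4 ∂P ≤ K) (n : ℕ) :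
    ∫ s, (∑ i ∈ Finset.range n, D i s) ^ 4 ∂P ≤ 19 * K * n ^ 2 := by
  have hDm := hD.hasAllMoments
  have hK0 : 0 ≤ K := (integral_nonneg fun s => by positivity).trans (hK 0)
  induction n with
  | zero => simp
  | succ n ih =>
    set M : Ω → ℝ := fun s => ∑ i ∈ Finset.range n, D i s
    have hM : HasAllMoments M P := by fun_prop
    have hcross : ∫ s, M s ^ 3 * D n s ∂P = 0 :=
      hD.integral_mul_eq_zero ((hD.measurable_sum_range n).pow_const 3) (hM.pow 3)
    have hn : (0 : ℝ) < n + 1 := by positivity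
    calc ∫ s, (∑ i ∈ Finset.range (n + 1), D i s) ^ 4 ∂P
        ≤ ∫ s, ((1 + ((n : ℝ) + 1)⁻¹) * M s ^ 4 + 4 * (M s ^ 3 * D n s)
            + (16 * ((n : ℝ) + 1) + 3) * D n s ^ 4) ∂P := by
          simp only [Finset.sum_range_succ]
          exact integral_mono (HasAllMoments.integrable (by fun_prop))
            (HasAllMoments.integrable (by fun_prop)) fun s => add_pow_four_le hn
      _ = (1 + ((n : ℝ) + 1)⁻¹) * ∫ s, M s ^ 4 ∂P
            + (16 * ((n : ℝ) + 1) + 3) * ∫ s, D n s ^ 4 ∂P := by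
          rw [integral_add (HasAllMoments.integrable (by fun_prop))
            (HasAllMoments.integrable (by fun_prop)), integral_add
            (HasAllMoments.integrable (by fun_prop)) (HasAllMoments.integrable (by fun_prop)),
            integral_const_mul, integral_const_mul, integral_const_mul, hcross, mul_zero, add_zero]
      _ ≤ (1 + ((n : ℝ) + 1)⁻¹) * (19 * K * n ^ 2) + (16 * ((n : ℝ) + 1) + 3) * K := by
          gcongr
          exact hK n
      _ ≤ 19 * K * ((n + 1 : ℕ) : ℝ) ^ 2 := by
          have hinv : ((n : ℝ) + 1)⁻¹ * n ^ 2 ≤ n := by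
            rw [inv_mul_le_iff₀ hn]
            nlinarith
          push_cast
          nlinarith [mul_le_mul_of_nonneg_left hinv hK0, mul_nonneg hK0 n.cast_nonneg]

end IsMartingaleDifference

theorem integral_sq_le_of_integral_pow_four_le [IsProbabilityMeasure P] {f : Ω → ℝ}
    (hf : HasAllMoments f P) {K m : ℝ} (hm : 0 < m) (h : ∫ s, f s ^ 4 ∂P ≤ K * m ^ 2) :
    ∫ s, f s ^ 2 ∂P ≤ (K + 1) * m := by
  have hpt (s : Ω) : f s ^ 2 ≤ m⁻¹ * f s ^ 4 + m := by
    have : m⁻¹ * f s ^ 4 + m - f s ^ 2 = ((f s ^ 2 - m / 2) ^ 2 + 3 / 4 * m ^ 2) / m := by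
      field_simp
      ring
    rw [← sub_nonneg, this]
    positivity
  calc ∫ s, f s ^ 2 ∂P ≤ ∫ s, (m⁻¹ * f s ^ 4 + m) ∂P :=
        integral_mono (HasAllMoments.integrable (by fun_prop))
          (HasAllMoments.integrable (by fun_prop)) hpt
    _ = m⁻¹ * ∫ s, f s ^ 4 ∂P + m := by
        rw [integral_add (HasAllMoments.integrable (by fun_prop)) (integrable_const m),
          integral_const_mul]
        simp
    _ ≤ m⁻¹ * (K * m ^ 2) + m := by gcongr
    _ = (K + 1) * m := by field_simp

end MartingaleDifference

section MaximalGrowth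

variable {Ω : Type*} [MeasurableSpace Ω] {P : Measure Ω}

/-- The expected maximum of `|Z 0|, …, |Z (m - 1)|` is `o(log m)`. The maximum is replaced by an
integrable upper bound `B`, so that no measurability of `Z` is involved. -/
def HasLogLittleOMax (Z : ℕ → Ω → ℝ) (P : Measure Ω) : Prop :=
  ∀ η > 0, ∃ K, ∀ m : ℕ, 1 ≤ m → ∃ B : Ω → ℝ, Integrable B P ∧ (∀ i < m, ∀ s, |Z i s| ≤ B s) ∧
    ∫ s, B s ∂P ≤ η * Real.log m + K

namespace HasLogLittleOMax

variable {Z Z' : ℕ → Ω → ℝ}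

theorem mono (hZ : HasLogLittleOMax Z P) (h : ∀ i s, |Z' i s| ≤ |Z i s|) :
    HasLogLittleOMax Z' P := fun η hη => by
  obtain ⟨K, hK⟩ := hZ η hη
  refine ⟨K, fun m hm => ?_⟩
  obtain ⟨B, hB, hZB, hBK⟩ := hK m hm
  exact ⟨B, hB, fun i hi s => (h i s).trans (hZB i hi s), hBK⟩

theorem of_abs_le [IsProbabilityMeasure P] {a : ℕ → ℝ} {A : ℝ} (ha : ∀ i, |a i| ≤ A) :
    HasLogLittleOMax (fun i _ => a i) P :=
  fun η hη => ⟨A, fun m _ => ⟨fun _ => A, integrable_const _, fun i _ _ => ha i, by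
    simpa using mul_nonneg hη.le (Real.log_natCast_nonneg m)⟩⟩

theorem add (hZ : HasLogLittleOMax Z P) (hZ' : HasLogLittleOMax Z' P) :
    HasLogLittleOMax (fun i s => Z i s + Z' i s) P := fun η hη => by
  obtain ⟨K, hK⟩ := hZ (η / 2) (half_pos hη)
  obtain ⟨K', hK'⟩ := hZ' (η / 2) (half_pos hη)
  refine ⟨K + K', fun m hm => ?_⟩
  obtain ⟨B, hB, hZB, hBK⟩ := hK m hm
  obtain ⟨B', hB', hZB', hBK'⟩ := hK' m hm
  refine ⟨fun s => B s + B' s, hB.add hB', fun i hi s =>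
    (abs_add_le _ _).trans (add_le_add (hZB i hi s) (hZB' i hi s)), ?_⟩
  rw [integral_add hB hB']
  linarith

theorem const_mul (a : ℝ) (hZ : HasLogLittleOMax Z P) :
    HasLogLittleOMax (fun i s => a * Z i s) P := fun η hη => by
  obtain ⟨K, hK⟩ := hZ (η / (|a| + 1)) (by positivity)
  refine ⟨|a| * K, fun m hm => ?_⟩
  obtain ⟨B, hB, hZB, hBK⟩ := hK m hm
  refine ⟨fun s => |a| * B s, hB.const_mul _, fun i hi s => ?_, ?_⟩
  · rw [abs_mul]
    exact mul_le_mul_of_nonneg_left (hZB i hi s) (abs_nonneg a)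
  · have hratio : |a| * (η / (|a| + 1)) ≤ η := by
      rw [← mul_div_assoc, div_le_iff₀ (by positivity)]
      nlinarith
    rw [integral_const_mul]
    calc |a| * ∫ s, B s ∂P ≤ |a| * (η / (|a| + 1) * Real.log m + K) := by gcongr
      _ = |a| * (η / (|a| + 1)) * Real.log m + |a| * K := by ring
      _ ≤ η * Real.log m + |a| * K := by gcongr

theorem sum [IsProbabilityMeasure P] {κ : Type*} (t : Finset κ) {Z : κ → ℕ → Ω → ℝ}
    (hZ : ∀ k ∈ t, HasLogLittleOMax (Z k) P) :
    HasLogLittleOMax (fun i s => ∑ k ∈ t, Z k i s) P := by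
  classical
  induction t using Finset.induction_on with
  | empty => simpa using of_abs_le (P := P) (a := 0) (A := 0) (by simp)
  | insert k t hk ih =>
    simp only [Finset.sum_insert hk]
    exact (hZ k (Finset.mem_insert_self k t)).add
      (ih fun j hj => hZ j (Finset.mem_insert_of_mem hj))

theorem of_integral_exp_le [IsProbabilityMeasure P]
    (hint : ∀ t i, Integrable (fun s => Real.exp (t * |Z i s|)) P)
    (hle : ∀ t, ∃ C, ∀ i, ∫ s, Real.exp (t * |Z i s|) ∂P ≤ C) : HasLogLittleOMax Z P :=
  fun η hη => by
  obtain ⟨C, hC⟩ := hle η⁻¹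
  refine ⟨η * C, fun m hm => ?_⟩
  have hm0 : (0 : ℝ) < m := by exact_mod_cast hm
  have hsum : Integrable (fun s => ∑ i ∈ Finset.range m, Real.exp (η⁻¹ * |Z i s|)) P :=
    integrable_finsetSum _ fun i _ => hint η⁻¹ i
  refine ⟨fun s => η * (Real.log m + (∑ i ∈ Finset.range m, Real.exp (η⁻¹ * |Z i s|)) / m),
    ((integrable_const _).add (hsum.div_const _)).const_mul _, fun i hi s => ?_, ?_⟩
  · rw [← inv_mul_le_iff₀ hη, ← sub_le_iff_le_add']
    calc η⁻¹ * |Z i s| - Real.log m ≤ Real.exp (η⁻¹ * |Z i s| - Real.log m) := by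
          linarith [Real.add_one_le_exp (η⁻¹ * |Z i s| - Real.log m)]
      _ = Real.exp (η⁻¹ * |Z i s|) / m := by rw [Real.exp_sub, Real.exp_log hm0]
      _ ≤ (∑ i ∈ Finset.range m, Real.exp (η⁻¹ * |Z i s|)) / m := by
          gcongr
          exact Finset.single_le_sum (f := fun i => Real.exp (η⁻¹ * |Z i s|))
            (fun _ _ => (Real.exp_pos _).le) (Finset.mem_range.2 hi)
  · have hmean : ∑ i ∈ Finset.range m, ∫ s, Real.exp (η⁻¹ * |Z i s|) ∂P ≤ C * m := by
      simpa [mul_comm] using Finset.sum_le_sum fun i (_ : i ∈ Finset.range m) => hC i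
    rw [integral_const_mul, integral_add (integrable_const _) (hsum.div_const _),
      integral_div, integral_finsetSum _ fun i _ => hint η⁻¹ i, ← mul_add]
    simpa using mul_le_mul_of_nonneg_left
      (add_le_add_right ((div_le_iff₀ hm0).2 hmean) (Real.log m)) hη.le

end HasLogLittleOMax

theorem IsLpBigO.hasLogLittleOMax [IsProbabilityMeasure P] {W : ℕ → Ω → ℝ}
    (hW : IsLpBigO W (fun i => (√((i : ℝ) + 1))⁻¹) P) : HasLogLittleOMax W P := fun η hη => by
  have hWm := hW.hasAllMoments
  obtain ⟨C, hC⟩ := hW.exists_integral_pow_le (n := 4) (by decide) (by decide)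
  have hrate (i : ℕ) : (√((i : ℝ) + 1))⁻¹ ^ 4 = (((i + 1 : ℕ) : ℝ) ^ 2)⁻¹ := by
    rw [inv_pow, pow_mul (√((i : ℝ) + 1)) 2 2, Real.sq_sqrt (by positivity)]
    push_cast
    rfl
  have hC0 : 0 ≤ C := by
    simpa using (integral_nonneg fun s => by positivity).trans (hC 0)
  have hsummable : Summable fun i : ℕ => C * (((i + 1 : ℕ) : ℝ) ^ 2)⁻¹ :=
    ((summable_nat_add_iff 1).2 (Real.summable_nat_pow_inv.2 one_lt_two)).mul_left C
  refine ⟨1 + ∑' i : ℕ, C * (((i + 1 : ℕ) : ℝ) ^ 2)⁻¹, fun m _ =>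
    ⟨fun s => 1 + ∑ i ∈ Finset.range m, W i s ^ 4, HasAllMoments.integrable (by fun_prop),
      fun i hi s => ?_, ?_⟩⟩
  · have hle : |W i s| ≤ 1 + |W i s| ^ 4 := by
      nlinarith [sq_nonneg (|W i s| ^ 2 - 1), sq_nonneg (|W i s| - 1)]
    rw [Even.pow_abs (by decide)] at hle
    refine hle.trans (add_le_add_right ?_ 1)
    exact Finset.single_le_sum (f := fun i => W i s ^ 4) (fun _ _ => by positivity)
      (Finset.mem_range.2 hi)
  · rw [integral_add (integrable_const 1) (HasAllMoments.integrable (by fun_prop)),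
      integral_finsetSum _ fun i _ => HasAllMoments.integrable (by fun_prop)]
    have hsum : ∑ i ∈ Finset.range m, ∫ s, W i s ^ 4 ∂P
        ≤ ∑' i : ℕ, C * (((i + 1 : ℕ) : ℝ) ^ 2)⁻¹ :=
      (Finset.sum_le_sum fun i _ => (hC i).trans_eq (by rw [hrate])).trans
        (hsummable.sum_le_tsum _ fun i _ => by positivity)
    have hlog : 0 ≤ η * Real.log m := mul_nonneg hη.le (Real.log_natCast_nonneg m)
    rw [integral_const, probReal_univ, one_smul]
    linarith

end MaximalGrowth

section StoppingBelowLevel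

variable {Ω : Type*} {Z : ℕ → Ω → ℝ} {b : ℝ} {m i : ℕ} {s : Ω}

/-- The event that the partial sums of `Z` of orders `0, …, i` all lie below `b`, that is, the sum
passes the level `b` after more than `i` steps. -/
def belowUntil (Z : ℕ → Ω → ℝ) (b : ℝ) (i : ℕ) : Set Ω :=
  {s | ∀ n ≤ i, ∑ j ∈ Finset.range n, Z j s < b}

open Classical in
/-- The number of steps after which the partial sums of `Z` pass the level `b`, truncated at `m`. -/
noncomputable def stopCount (Z : ℕ → Ω → ℝ) (b : ℝ) (m : ℕ) (s : Ω) : ℕ :=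
  Nat.count (fun i => s ∈ belowUntil Z b i) m

theorem antitone_belowUntil : Antitone (belowUntil Z b) :=
  fun _ _ hij _ hs n hn => hs n (hn.trans hij)

theorem stopCount_le : stopCount Z b m s ≤ m := by
  classical exact Nat.count_le _

theorem lt_stopCount_iff (hi : i < m) : i < stopCount Z b m s ↔ s ∈ belowUntil Z b i := by
  classical
  rw [stopCount]
  refine ⟨fun h => by_contra fun hs => ?_, fun hs => ?_⟩
  · obtain ⟨k, rfl⟩ := Nat.exists_eq_add_of_le hi.le
    have hzero : Nat.count (fun j => s ∈ belowUntil Z b (i + j)) k = 0 :=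
      Nat.count_iff_forall_not.2 fun j _ hj => hs (antitone_belowUntil (i.le_add_right j) hj)
    rw [Nat.count_add, hzero, add_zero] at h
    exact h.not_ge (Nat.count_le _)
  · have hfull : Nat.count (fun j => s ∈ belowUntil Z b j) (i + 1) = i + 1 :=
      Nat.count_iff_forall.2 fun j hj => antitone_belowUntil (Nat.lt_succ_iff.1 hj) hs
    calc i < i + 1 := i.lt_succ_self
      _ = Nat.count (fun j => s ∈ belowUntil Z b j) (i + 1) := hfull.symm
      _ ≤ Nat.count (fun j => s ∈ belowUntil Z b j) m := Nat.count_monotone _ hi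

theorem one_le_stopCount (hb : 0 < b) (hm : 1 ≤ m) : 1 ≤ stopCount Z b m s :=
  (lt_stopCount_iff hm).2 fun n hn => by simpa [Nat.le_zero.1 hn] using hb

theorem sum_range_stopCount_sub_one_lt (hb : 0 < b) (hm : 1 ≤ m) :
    ∑ j ∈ Finset.range (stopCount Z b m s - 1), Z j s < b := by
  have hT := one_le_stopCount (Z := Z) (s := s) hb hm
  have hTm := stopCount_le (Z := Z) (b := b) (m := m) (s := s)
  exact (lt_stopCount_iff (by omega)).1 (Nat.sub_lt hT one_pos) _ le_rfl

theorem sum_range_stopCount_lt_add (hb : 0 < b) (hm : 1 ≤ m) :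
    ∑ j ∈ Finset.range (stopCount Z b m s), Z j s < b + Z (stopCount Z b m s - 1) s := by
  have hsplit := Finset.sum_range_succ (fun j => Z j s) (stopCount Z b m s - 1)
  rw [Nat.sub_add_cancel (one_le_stopCount hb hm)] at hsplit
  linarith [sum_range_stopCount_sub_one_lt (Z := Z) (s := s) hb hm]

theorem min_le_sum_range_stopCount :
    min b (∑ j ∈ Finset.range m, Z j s) ≤ ∑ j ∈ Finset.range (stopCount Z b m s), Z j s := by
  rcases (stopCount_le (Z := Z) (b := b) (m := m) (s := s)).lt_or_eq with hlt | heq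
  · refine min_le_of_left_le (le_of_not_gt fun h => (lt_irrefl (stopCount Z b m s)) ?_)
    refine (lt_stopCount_iff hlt).2 fun n hn => ?_
    rcases hn.lt_or_eq with hn | rfl
    · exact (lt_stopCount_iff (hn.trans hlt)).1 hn n le_rfl
    · exact h
  · rw [heq]
    exact min_le_right _ _

theorem sum_indicator_belowUntil (f : ℕ → Ω → ℝ) :
    ∑ i ∈ Finset.range m, (belowUntil Z b i).indicator (f i) s
      = ∑ i ∈ Finset.range (stopCount Z b m s), f i s := by
  classical
  simp only [Set.indicator_apply]
  rw [← Finset.sum_filter]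
  congr 1
  ext i
  rw [Finset.mem_filter, Finset.mem_range, Finset.mem_range]
  exact ⟨fun ⟨hi, hs⟩ => (lt_stopCount_iff hi).2 hs,
    fun hi => ⟨hi.trans_le stopCount_le, (lt_stopCount_iff (hi.trans_le stopCount_le)).1 hi⟩⟩

theorem natCast_stopCount_eq_sum : (stopCount Z b m s : ℝ)
    = ∑ i ∈ Finset.range m, (belowUntil Z b i).indicator (fun _ => 1) s := by
  simp [sum_indicator_belowUntil (fun _ _ => (1 : ℝ))]

theorem sq_sum_range_stopCount_sub_le (hb : 0 < b) (hm : 1 ≤ m) {x : ℝ} (hbx : b ≤ x) :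
    (∑ i ∈ Finset.range (stopCount Z b m s), Z i s - b) ^ 2
      ≤ ∑ i ∈ Finset.range m, Z i s ^ 2 + (∑ i ∈ Finset.range m, Z i s - x) ^ 2 := by
  have hovershoot := sum_range_stopCount_lt_add (Z := Z) (s := s) hb hm
  have hundershoot := min_le_sum_range_stopCount (Z := Z) (b := b) (m := m) (s := s)
  have hlast : Z (stopCount Z b m s - 1) s ^ 2 ≤ ∑ i ∈ Finset.range m, Z i s ^ 2 :=
    Finset.single_le_sum (f := fun i => Z i s ^ 2) (fun i _ => sq_nonneg _)
      (Finset.mem_range.2 (by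
        have := one_le_stopCount (Z := Z) (s := s) hb hm
        have := stopCount_le (Z := Z) (b := b) (m := m) (s := s)
        omega))
  set y := ∑ i ∈ Finset.range (stopCount Z b m s), Z i s
  set S := ∑ i ∈ Finset.range m, Z i s
  rcases le_total b y with hle | hle
  · nlinarith [sq_nonneg (S - x)]
  · rcases min_le_iff.1 hundershoot with h | h
    · nlinarith [sq_nonneg (S - x), sq_nonneg (Z (stopCount Z b m s - 1) s), le_antisymm hle h]
    · nlinarith [sq_nonneg (Z (stopCount Z b m s - 1) s)]

variable {mΩ : MeasurableSpace Ω} {F : Filtration ℕ mΩ} {P : Measure Ω}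

theorem measurableSet_belowUntil (hZ : ∀ i, Measurable[F (i + 1)] (Z i)) (b : ℝ) (i : ℕ) :
    MeasurableSet[F i] (belowUntil Z b i) := by
  have hinter : belowUntil Z b i = ⋂ n, ⋂ _ : n ≤ i, {s | ∑ j ∈ Finset.range n, Z j s < b} := by
    ext s
    simp [belowUntil]
  rw [hinter]
  refine MeasurableSet.iInter fun n => MeasurableSet.iInter fun hn => ?_
  have hS : Measurable[F i] fun s => ∑ j ∈ Finset.range n, Z j s :=
    Finset.measurable_fun_sum _ fun j hj =>
      (hZ j).mono (F.mono ((Finset.mem_range.1 hj).trans_le hn)) le_rfl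
  exact hS measurableSet_Iio

theorem HasAllMoments.sum_range_stopCount (hZ : ∀ i, Measurable[F (i + 1)] (Z i))
    {f : ℕ → Ω → ℝ} (hf : ∀ i, HasAllMoments (f i) P) :
    HasAllMoments (fun s => ∑ i ∈ Finset.range (stopCount Z b m s), f i s) P := by
  simp only [← sum_indicator_belowUntil]
  exact .sum _ fun i _ => (hf i).indicator (F.le i _ (measurableSet_belowUntil hZ b i))

theorem HasAllMoments.natCast_stopCount [IsFiniteMeasure P]
    (hZ : ∀ i, Measurable[F (i + 1)] (Z i)) :
    HasAllMoments (fun s => (stopCount Z b m s : ℝ)) P := by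
  simpa using sum_range_stopCount (b := b) (m := m) hZ fun _ => HasAllMoments.const (P := P) 1

theorem integral_natCast_stopCount [IsFiniteMeasure P] (hZ : ∀ i, Measurable[F (i + 1)] (Z i)) :
    ∫ s, (stopCount Z b m s : ℝ) ∂P = ∑ i ∈ Finset.range m, P.real (belowUntil Z b i) := by
  have hA (i : ℕ) : MeasurableSet (belowUntil Z b i) := F.le i _ (measurableSet_belowUntil hZ b i)
  simp only [natCast_stopCount_eq_sum]
  rw [integral_finsetSum _ fun i _ => (integrable_const 1).indicator (hA i)]
  refine Finset.sum_congr rfl fun i _ => ?_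
  rw [integral_indicator_const _ (hA i), smul_eq_mul, mul_one]

variable {D : ℕ → Ω → ℝ}

theorem IsMartingaleDifference.integral_sum_range_stopCount_eq_zero [IsFiniteMeasure P]
    (hD : IsMartingaleDifference D F P) (hZ : ∀ i, Measurable[F (i + 1)] (Z i)) :
    ∫ s, ∑ i ∈ Finset.range (stopCount Z b m s), D i s ∂P = 0 := by
  simpa only [sum_indicator_belowUntil] using
    (hD.indicator (measurableSet_belowUntil hZ b)).integral_sum_range_eq_zero m

theorem IsMartingaleDifference.integral_sum_range_stopCount_pow_four_le [IsFiniteMeasure P]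
    (hD : IsMartingaleDifference D F P) (hZ : ∀ i, Measurable[F (i + 1)] (Z i)) {K : ℝ}
    (hK : ∀ i, ∫ s, D i s ^ 4 ∂P ≤ K) :
    ∫ s, (∑ i ∈ Finset.range (stopCount Z b m s), D i s) ^ 4 ∂P ≤ 19 * K * m ^ 2 := by
  have hstopped := hD.indicator (measurableSet_belowUntil hZ b)
  have hle (i : ℕ) (s : Ω) : (belowUntil Z b i).indicator (D i) s ^ 4 ≤ D i s ^ 4 := by
    have hnonneg : 0 ≤ D i s ^ 4 := (even_two_mul 2).pow_nonneg _
    by_cases hs : s ∈ belowUntil Z b i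
    · rw [Set.indicator_of_mem hs]
    · rwa [Set.indicator_of_notMem hs, zero_pow four_ne_zero]
  have hmoment (i : ℕ) : ∫ s, (belowUntil Z b i).indicator (D i) s ^ 4 ∂P ≤ K :=
    (integral_mono ((hstopped.hasAllMoments i).pow 4).integrable
      ((hD.hasAllMoments i).pow 4).integrable (hle i)).trans (hK i)
  simpa only [sum_indicator_belowUntil] using hstopped.integral_sum_range_pow_four_le hmoment m

end StoppingBelowLevel

/-- `Z` is the sequence of increments of a random walk with drift `I` (and no drift in the first
step), driven by martingale differences `D` and perturbed by a remainder `R i = O(i ^ (-1 / 2))`. -/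
structure IsPerturbedWalk {Ω : Type*} {mΩ : MeasurableSpace Ω} (Z D R : ℕ → Ω → ℝ) (I : ℝ)
    (F : Filtration ℕ mΩ) (P : Measure Ω) : Prop where
  drift_pos : 0 < I
  eq_add_sub (i : ℕ) (s : Ω) : Z i s = (if i = 0 then 0 else I) + D i s - R i s
  isMartingaleDifference : IsMartingaleDifference D F P
  isLpBigO_noise : IsLpBigO D 1 P
  hasLogLittleOMax_noise : HasLogLittleOMax D P
  measurable_rem (i : ℕ) : Measurable[F (i + 1)] (R i)
  isLpBigO_rem : IsLpBigO R (fun i => (√((i : ℝ) + 1))⁻¹) P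

namespace IsPerturbedWalk

variable {Ω : Type*} {mΩ : MeasurableSpace Ω} {P : Measure Ω} {F : Filtration ℕ mΩ}
  {Z D R : ℕ → Ω → ℝ} {I : ℝ}

theorem measurable (H : IsPerturbedWalk Z D R I F P) (i : ℕ) : Measurable[F (i + 1)] (Z i) := by
  rw [funext (H.eq_add_sub i)]
  exact (measurable_const.add (H.isMartingaleDifference.measurable i)).sub (H.measurable_rem i)

theorem eq_add_add_neg_one_mul (H : IsPerturbedWalk Z D R I F P) :
    Z = fun i s => (if i = 0 then 0 else I) + D i s + -1 * R i s := by
  ext i s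
  rw [H.eq_add_sub, neg_one_mul, sub_eq_add_neg]

theorem sum_range_eq (H : IsPerturbedWalk Z D R I F P) {n : ℕ} (hn : 1 ≤ n) (s : Ω) :
    ∑ i ∈ Finset.range n, Z i s
      = I * (n - 1) + ∑ i ∈ Finset.range n, D i s - ∑ i ∈ Finset.range n, R i s := by
  simp only [H.eq_add_sub, Finset.sum_add_distrib, Finset.sum_sub_distrib]
  congr 2
  obtain ⟨n, rfl⟩ := Nat.exists_eq_succ_of_ne_zero (Nat.one_le_iff_ne_zero.1 hn)
  rw [Finset.sum_range_succ']
  simp [mul_comm]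

variable [IsProbabilityMeasure P]

theorem isLpBigO (H : IsPerturbedWalk Z D R I F P) : IsLpBigO Z 1 P := by
  have hrate (i : ℕ) : (√((i : ℝ) + 1))⁻¹ ≤ 1 :=
    inv_le_one_of_one_le₀ (Real.one_le_sqrt.2 (by simp))
  have hR : IsLpBigO R 1 P :=
    H.isLpBigO_rem.mono (A := 1) (fun i => by positivity) (by simpa using hrate)
  rw [H.eq_add_add_neg_one_mul]
  exact ((IsLpBigO.of_abs_le (abs_ite_eq_zero_le I)).add H.isLpBigO_noise).add (hR.const_mul (-1))

theorem hasLogLittleOMax (H : IsPerturbedWalk Z D R I F P) : HasLogLittleOMax Z P := by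
  rw [H.eq_add_add_neg_one_mul]
  exact ((HasLogLittleOMax.of_abs_le (abs_ite_eq_zero_le I)).add H.hasLogLittleOMax_noise).add
    (H.isLpBigO_rem.hasLogLittleOMax.const_mul (-1))

theorem exists_integral_sum_range_sub_pow_four_le (H : IsPerturbedWalk Z D R I F P) :
    ∃ K, ∀ m : ℕ, 1 ≤ m →
      ∫ s, (∑ i ∈ Finset.range m, Z i s - I * m) ^ 4 ∂P ≤ K * (m : ℝ) ^ 2 := by
  obtain ⟨C, hC⟩ := H.isLpBigO_noise.exists_integral_pow_le (n := 4) (by decide) (by decide)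
  obtain ⟨C', hC'⟩ :=
    H.isLpBigO_rem.sum_range_of_inv_sqrt.exists_integral_pow_le (n := 4) (by decide) (by decide)
  have hD := H.isLpBigO_noise.hasAllMoments
  have hR := H.isLpBigO_rem.hasAllMoments
  have hZ := H.isLpBigO.hasAllMoments
  refine ⟨27 * (19 * C + C' + I ^ 4), fun m hm => ?_⟩
  have hmart := H.isMartingaleDifference.integral_sum_range_pow_four_le (K := C)
    (by simpa using hC) m
  have hrem : ∫ s, (∑ i ∈ Finset.range m, R i s) ^ 4 ∂P ≤ C' * (m : ℝ) ^ 2 := by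
    have hsqrt : √(m : ℝ) ^ 4 = (m : ℝ) ^ 2 := by
      rw [pow_mul (√(m : ℝ)) 2 2, Real.sq_sqrt m.cast_nonneg]
    exact (hC' m).trans_eq (by rw [hsqrt])
  calc ∫ s, (∑ i ∈ Finset.range m, Z i s - I * m) ^ 4 ∂P
      ≤ ∫ s, 27 * ((∑ i ∈ Finset.range m, D i s) ^ 4 + (∑ i ∈ Finset.range m, R i s) ^ 4
          + I ^ 4) ∂P := by
        refine integral_mono (HasAllMoments.integrable (by fun_prop))
          (HasAllMoments.integrable (by fun_prop)) fun s => ?_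
        have hdev : ∑ i ∈ Finset.range m, Z i s - I * m
            = ∑ i ∈ Finset.range m, D i s - ∑ i ∈ Finset.range m, R i s - I := by
          rw [H.sum_range_eq hm]
          ring
        simpa only [hdev] using sub_sub_pow_four_le _ _ _
    _ = 27 * (∫ s, (∑ i ∈ Finset.range m, D i s) ^ 4 ∂P
          + ∫ s, (∑ i ∈ Finset.range m, R i s) ^ 4 ∂P + I ^ 4) := by
        rw [integral_const_mul, integral_add (HasAllMoments.integrable (by fun_prop))
          (integrable_const _), integral_add (HasAllMoments.integrable (by fun_prop))
          (HasAllMoments.integrable (by fun_prop))]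
        simp
    _ ≤ 27 * (19 * C * (m : ℝ) ^ 2 + C' * (m : ℝ) ^ 2 + I ^ 4 * (m : ℝ) ^ 2) := by
        gcongr
        exact le_mul_of_one_le_right (by positivity) (one_le_pow₀ (by exact_mod_cast hm))
    _ = 27 * (19 * C + C' + I ^ 4) * (m : ℝ) ^ 2 := by ring

theorem exists_integral_sum_range_sub_sq_le (H : IsPerturbedWalk Z D R I F P) :
    ∃ K, ∀ m : ℕ, 1 ≤ m → ∫ s, (∑ i ∈ Finset.range m, Z i s - I * m) ^ 2 ∂P ≤ K * m := by
  obtain ⟨K, hK⟩ := H.exists_integral_sum_range_sub_pow_four_le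
  have hZ := H.isLpBigO.hasAllMoments
  exact ⟨K + 1, fun m hm => integral_sq_le_of_integral_pow_four_le (by fun_prop)
    (by exact_mod_cast hm) (hK m hm)⟩

theorem summable_real_sum_range_le (H : IsPerturbedWalk Z D R I F P) :
    Summable fun n : ℕ => P.real {s | ∑ i ∈ Finset.range n, Z i s ≤ I * n / 2} := by
  obtain ⟨K, hK⟩ := H.exists_integral_sum_range_sub_pow_four_le
  have hI := H.drift_pos
  have hZ := H.isLpBigO.hasAllMoments
  rw [← summable_nat_add_iff 1]
  refine Summable.of_nonneg_of_le (fun _ => measureReal_nonneg) (fun n => ?_)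
    ((summable_nat_add_iff 1).2 ((Real.summable_nat_pow_inv.2 one_lt_two).mul_left
      (K * (2 / I) ^ 4)))
  have hn : (0 : ℝ) < (n + 1 : ℕ) := by positivity
  set x : ℝ := ((n + 1 : ℕ) : ℝ)
  have hsub : {s | ∑ i ∈ Finset.range (n + 1), Z i s ≤ I * x / 2}
      ⊆ {s | (I * x / 2) ^ 4 ≤ (∑ i ∈ Finset.range (n + 1), Z i s - I * x) ^ 4} := fun s hs => by
    have hdev : I * x / 2 ≤ I * x - ∑ i ∈ Finset.range (n + 1), Z i s := by
      have : ∑ i ∈ Finset.range (n + 1), Z i s ≤ I * x / 2 := hs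
      linarith
    rw [Set.mem_ofPred_eq, ← neg_sub, Even.neg_pow (by decide)]
    exact pow_le_pow_left₀ (by positivity) hdev 4
  have hmarkov := mul_meas_ge_le_integral_of_nonneg (μ := P)
    (f := fun s => (∑ i ∈ Finset.range (n + 1), Z i s - I * x) ^ 4)
    (ae_of_all _ fun s => by positivity) (HasAllMoments.integrable (by fun_prop)) ((I * x / 2) ^ 4)
  calc P.real {s | ∑ i ∈ Finset.range (n + 1), Z i s ≤ I * x / 2}
      ≤ P.real {s | (I * x / 2) ^ 4 ≤ (∑ i ∈ Finset.range (n + 1), Z i s - I * x) ^ 4} :=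
        measureReal_mono hsub
    _ ≤ K * x ^ 2 / (I * x / 2) ^ 4 := by
        rw [le_div_iff₀' (by positivity)]
        exact hmarkov.trans (hK (n + 1) (by omega))
    _ = K * (2 / I) ^ 4 * (x ^ 2)⁻¹ := by field_simp

end IsPerturbedWalk

theorem IsLpBigO.exists_sum_weight_mul_integral_sq_le {Ω : Type*} [MeasurableSpace Ω]
    {P : Measure Ω} {f : ℕ → Ω → ℝ}
    (hf : IsLpBigO f (fun i => (√((i : ℝ) + 1))⁻¹) P) :
    ∃ C, 0 < C ∧ ∀ N : ℕ,
      ∑ i ∈ Finset.range (N + N), (N : ℝ) / (|(i : ℝ) - N| + 1) * ∫ s, f i s ^ 2 ∂P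
        ≤ C * (1 + Real.log (N + N : ℕ)) := by
  obtain ⟨C, hC⟩ := hf.exists_integral_pow_le even_two two_ne_zero
  refine ⟨(|C| + 1) * 3, by positivity, fun N => ?_⟩
  have hterm (i : ℕ) : ∫ s, f i s ^ 2 ∂P ≤ (|C| + 1) * ((i : ℝ) + 1)⁻¹ := by
    refine (hC i).trans ?_
    rw [inv_pow, Real.sq_sqrt (by positivity)]
    gcongr
    linarith [le_abs_self C]
  calc ∑ i ∈ Finset.range (N + N), (N : ℝ) / (|(i : ℝ) - N| + 1) * ∫ s, f i s ^ 2 ∂P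
      ≤ ∑ i ∈ Finset.range (N + N),
          (N : ℝ) / (|(i : ℝ) - N| + 1) * ((|C| + 1) * ((i : ℝ) + 1)⁻¹) := by
        gcongr with i
        exact hterm i
    _ = (|C| + 1) * ∑ i ∈ Finset.range (N + N),
          (N : ℝ) / (|(i : ℝ) - N| + 1) * ((i : ℝ) + 1)⁻¹ := by
        rw [Finset.mul_sum]
        exact Finset.sum_congr rfl fun i _ => mul_left_comm _ _ _
    _ ≤ (|C| + 1) * 3 * (1 + Real.log (N + N : ℕ)) := by
        rw [mul_assoc]
        gcongr
        exact sum_weight_mul_inv_succ_le N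

namespace IsPerturbedWalk

variable {Ω : Type*} {mΩ : MeasurableSpace Ω} {P : Measure Ω} {F : Filtration ℕ mΩ}
  {Z D R : ℕ → Ω → ℝ} {I b : ℝ} {m N : ℕ}

theorem sq_stopCount_sub_le (H : IsPerturbedWalk Z D R I F P) (hb : 0 < b) (hm : 1 ≤ m)
    (hbm : b ≤ I * m) (hN : |b - I * N| ≤ I) (s : Ω) :
    I ^ 2 * ((stopCount Z b m s : ℝ) - N) ^ 2
      ≤ 4 * (∑ i ∈ Finset.range m, Z i s ^ 2 + (∑ i ∈ Finset.range m, Z i s - I * m) ^ 2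
        + (∑ i ∈ Finset.range (stopCount Z b m s), D i s) ^ 2
        + (∑ i ∈ Finset.range m, |R i s|) ^ 2 + 4 * I ^ 2) := by
  have hlevel := sq_sum_range_stopCount_sub_le (Z := Z) (s := s) hb hm hbm
  have hwald := H.sum_range_eq (one_le_stopCount (Z := Z) (s := s) hb hm) s
  have hrem : (∑ i ∈ Finset.range (stopCount Z b m s), R i s) ^ 2
      ≤ (∑ i ∈ Finset.range m, |R i s|) ^ 2 := by
    refine sq_le_sq' ?_ ?_
    all_goals
      have habs := (Finset.abs_sum_le_sum_abs (fun i => R i s)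
        (Finset.range (stopCount Z b m s))).trans (Finset.sum_le_sum_of_subset_of_nonneg
          (Finset.range_mono stopCount_le) fun i _ _ => abs_nonneg _)
      linarith [abs_le.1 habs]
  set T := (stopCount Z b m s : ℝ)
  set x := ∑ i ∈ Finset.range (stopCount Z b m s), Z i s - b with hx
  set d := ∑ i ∈ Finset.range (stopCount Z b m s), D i s
  set r := ∑ i ∈ Finset.range (stopCount Z b m s), R i s
  have hround : (I + (b - I * N)) ^ 2 ≤ 4 * I ^ 2 := by
    rw [abs_le] at hN
    nlinarith
  have hdecomp : I * (T - N) = x - d + r + (I + (b - I * N)) := by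
    rw [hx, hwald]
    ring
  calc I ^ 2 * (T - N) ^ 2 = (x - d + r + (I + (b - I * N))) ^ 2 := by rw [← mul_pow, hdecomp]
    _ ≤ 4 * (x ^ 2 + d ^ 2 + r ^ 2 + (I + (b - I * N)) ^ 2) := by
      nlinarith [sq_nonneg (x + d), sq_nonneg (x - r), sq_nonneg (x - (I + (b - I * N))),
        sq_nonneg (d + r), sq_nonneg (d + (I + (b - I * N))), sq_nonneg (r - (I + (b - I * N)))]
    _ ≤ _ := by linarith

variable [IsProbabilityMeasure P]

theorem exists_integral_sq_stopCount_sub_le (H : IsPerturbedWalk Z D R I F P) :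
    ∃ K, ∀ (b : ℝ) (N m : ℕ), 0 < b → 1 ≤ m → b ≤ I * m → |b - I * N| ≤ I →
      ∫ s, ((stopCount Z b m s : ℝ) - N) ^ 2 ∂P ≤ K * m := by
  have hI := H.drift_pos
  have hZ := H.isLpBigO.hasAllMoments
  have hR := H.isLpBigO_rem.hasAllMoments
  obtain ⟨C₁, hC₁⟩ := H.isLpBigO.exists_integral_pow_le even_two two_ne_zero
  obtain ⟨C₂, hC₂⟩ := H.exists_integral_sum_range_sub_sq_le
  obtain ⟨C₃, hC₃⟩ := H.isLpBigO_noise.exists_integral_pow_le (n := 4) (by decide) (by decide)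
  obtain ⟨C₄, hC₄⟩ :=
    H.isLpBigO_rem.abs.sum_range_of_inv_sqrt.exists_integral_pow_le even_two two_ne_zero
  refine ⟨(I ^ 2)⁻¹ * (4 * (C₁ + C₂ + (19 * C₃ + 1) + C₄ + 4 * I ^ 2)),
    fun b N m hb hm hbm hN => ?_⟩
  have hm0 : (1 : ℝ) ≤ m := by exact_mod_cast hm
  have hT : HasAllMoments (fun s => (stopCount Z b m s : ℝ)) P := .natCast_stopCount H.measurable
  have hM : HasAllMoments (fun s => ∑ i ∈ Finset.range (stopCount Z b m s), D i s) P :=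
    .sum_range_stopCount H.measurable H.isLpBigO_noise.hasAllMoments
  have hsqZ : ∫ s, ∑ i ∈ Finset.range m, Z i s ^ 2 ∂P ≤ C₁ * m := by
    rw [integral_finsetSum _ fun i _ => ((hZ i).pow 2).integrable]
    simpa [mul_comm] using Finset.sum_le_sum fun i (_ : i ∈ Finset.range m) => hC₁ i
  have hsqM := integral_sq_le_of_integral_pow_four_le hM (zero_lt_one.trans_le hm0)
    (H.isMartingaleDifference.integral_sum_range_stopCount_pow_four_le H.measurable
      (K := C₃) (by simpa using hC₃))
  have hsqR : ∫ s, (∑ i ∈ Finset.range m, |R i s|) ^ 2 ∂P ≤ C₄ * m :=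
    (hC₄ m).trans_eq (by rw [Real.sq_sqrt m.cast_nonneg])
  have hmain : I ^ 2 * ∫ s, ((stopCount Z b m s : ℝ) - N) ^ 2 ∂P
      ≤ 4 * (C₁ + C₂ + (19 * C₃ + 1) + C₄ + 4 * I ^ 2) * m := by
    rw [← integral_const_mul]
    refine (integral_mono (HasAllMoments.integrable (by fun_prop))
      (HasAllMoments.integrable (by fun_prop)) fun s =>
        H.sq_stopCount_sub_le hb hm hbm hN s).trans ?_
    rw [integral_const_mul, integral_add, integral_add, integral_add, integral_add]
    · have hconst : 4 * I ^ 2 ≤ 4 * I ^ 2 * m := le_mul_of_one_le_right (by positivity) hm0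
      simp only [integral_const, probReal_univ, one_smul]
      linarith [hC₂ m hm]
    all_goals exact HasAllMoments.integrable (by fun_prop)
  rw [mul_assoc, le_inv_mul_iff₀ (by positivity)]
  exact hmain

theorem integral_sum_range_stopCount_eq (H : IsPerturbedWalk Z D R I F P) (hb : 0 < b)
    (hm : 1 ≤ m) : ∫ s, ∑ i ∈ Finset.range (stopCount Z b m s), Z i s ∂P
      = I * (∫ s, (stopCount Z b m s : ℝ) ∂P) - I
        - ∫ s, ∑ i ∈ Finset.range (stopCount Z b m s), R i s ∂P := by
  have hT : HasAllMoments (fun s => (stopCount Z b m s : ℝ)) P := .natCast_stopCount H.measurable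
  have hM : HasAllMoments (fun s => ∑ i ∈ Finset.range (stopCount Z b m s), D i s) P :=
    .sum_range_stopCount H.measurable H.isLpBigO_noise.hasAllMoments
  have hR : HasAllMoments (fun s => ∑ i ∈ Finset.range (stopCount Z b m s), R i s) P :=
    .sum_range_stopCount H.measurable H.isLpBigO_rem.hasAllMoments
  simp only [H.sum_range_eq (one_le_stopCount hb hm)]
  rw [integral_sub (HasAllMoments.integrable (by fun_prop)) hR.integrable,
    integral_add (HasAllMoments.integrable (by fun_prop)) hM.integrable, integral_const_mul,
    integral_sub hT.integrable (integrable_const 1),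
    H.isMartingaleDifference.integral_sum_range_stopCount_eq_zero H.measurable]
  simp [mul_sub]

theorem integral_sum_range_stopCount_le (H : IsPerturbedWalk Z D R I F P) (hb : 0 < b)
    (hm : 1 ≤ m) {B : Ω → ℝ} (hB : Integrable B P) (hZB : ∀ i < m, ∀ s, Z i s ≤ B s) :
    ∫ s, ∑ i ∈ Finset.range (stopCount Z b m s), Z i s ∂P ≤ b + ∫ s, B s ∂P := by
  have hS : HasAllMoments (fun s => ∑ i ∈ Finset.range (stopCount Z b m s), Z i s) P :=
    .sum_range_stopCount H.measurable H.isLpBigO.hasAllMoments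
  calc ∫ s, ∑ i ∈ Finset.range (stopCount Z b m s), Z i s ∂P ≤ ∫ s, (b + B s) ∂P := by
        refine integral_mono hS.integrable ((integrable_const b).add hB) fun s => ?_
        have hlast := hZB (stopCount Z b m s - 1)
          ((Nat.sub_lt (one_le_stopCount hb hm) one_pos).trans_le stopCount_le) s
        have hovershoot := sum_range_stopCount_lt_add (Z := Z) (s := s) hb hm
        dsimp only
        linarith
    _ = b + ∫ s, B s ∂P := by
        rw [integral_add (integrable_const b) hB]
        simp

theorem exists_le_integral_sum_range_stopCount (H : IsPerturbedWalk Z D R I F P) :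
    ∃ K, ∀ (b : ℝ) (m : ℕ), 0 < b → 1 ≤ m → 2 * b ≤ I * m →
      b - K ≤ ∫ s, ∑ i ∈ Finset.range (stopCount Z b m s), Z i s ∂P := by
  obtain ⟨K, hK⟩ := H.exists_integral_sum_range_sub_sq_le
  have hI := H.drift_pos
  have hZ := H.isLpBigO.hasAllMoments
  refine ⟨K / (2 * I), fun b m hb hm hbm => ?_⟩
  have : (0 : ℝ) < m := by exact_mod_cast hm
  have hS : HasAllMoments (fun s => ∑ i ∈ Finset.range (stopCount Z b m s), Z i s) P :=
    .sum_range_stopCount H.measurable hZ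
  have hdev : (∫ s, (∑ i ∈ Finset.range m, Z i s - I * m) ^ 2 ∂P) / (2 * (I * m))
      ≤ K / (2 * I) := by
    rw [div_le_iff₀ (by positivity)]
    exact (hK m hm).trans_eq (by field_simp)
  calc b - K / (2 * I)
      ≤ b - (∫ s, (∑ i ∈ Finset.range m, Z i s - I * m) ^ 2 ∂P) / (2 * (I * m)) := by linarith
    _ = ∫ s, (b - (∑ i ∈ Finset.range m, Z i s - I * m) ^ 2 / (2 * (I * m))) ∂P := by
        rw [integral_sub (integrable_const b) (HasAllMoments.integrable (by fun_prop)),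
          integral_div]
        simp
    _ ≤ ∫ s, ∑ i ∈ Finset.range (stopCount Z b m s), Z i s ∂P :=
        integral_mono (HasAllMoments.integrable (by fun_prop)) hS.integrable fun s =>
          (sub_sq_div_le_min hb hbm).trans min_le_sum_range_stopCount

theorem exists_abs_integral_sum_range_stopCount_rem_sub_le (H : IsPerturbedWalk Z D R I F P)
    {η : ℝ} (hη : 0 < η) : ∃ K, ∀ (b : ℝ) (N : ℕ), 0 < b → 1 ≤ N → |b - I * N| ≤ I →
      |∫ s, ∑ i ∈ Finset.range (stopCount Z b (N + N) s), R i s ∂P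
        - ∑ i ∈ Finset.range N, ∫ s, R i s ∂P| ≤ η * Real.log (N + N : ℕ) + K := by
  have hI := H.drift_pos
  have hR := H.isLpBigO_rem.hasAllMoments
  obtain ⟨C, hC, hweighted⟩ := H.isLpBigO_rem.exists_sum_weight_mul_integral_sq_le
  obtain ⟨K, hK⟩ := H.exists_integral_sq_stopCount_sub_le
  set δ := η / C with hδdef
  have hδ : 0 < δ := by positivity
  refine ⟨η + K / δ, fun b N hb hN hbN => ?_⟩
  have hN0 : (1 : ℝ) ≤ N := by exact_mod_cast hN
  have hTR : HasAllMoments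
      (fun s => ∑ i ∈ Finset.range (stopCount Z b (N + N) s), R i s) P :=
    .sum_range_stopCount H.measurable hR
  have hT : HasAllMoments (fun s => (stopCount Z b (N + N) s : ℝ)) P :=
    .natCast_stopCount H.measurable
  have hspread := hK b N (N + N) hb (by omega)
    (by push_cast; nlinarith [(abs_le.1 hbN).2]) hbN
  rw [← integral_finsetSum _ fun i _ => (hR i).integrable,
    ← integral_sub hTR.integrable (HasAllMoments.integrable (by fun_prop))]
  calc |∫ s, (∑ i ∈ Finset.range (stopCount Z b (N + N) s), R i s
          - ∑ i ∈ Finset.range N, R i s) ∂P|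
      ≤ ∫ s, (δ * ∑ i ∈ Finset.range (N + N), (N : ℝ) / (|(i : ℝ) - N| + 1) * R i s ^ 2
          + ((stopCount Z b (N + N) s : ℝ) - N) ^ 2 / (2 * δ * N)) ∂P := by
        rw [← Real.norm_eq_abs]
        exact norm_integral_le_of_norm_le (HasAllMoments.integrable (by fun_prop))
          (ae_of_all _ fun s => abs_sum_range_sub_sum_range_le_weighted (fun i => R i s)
            stopCount_le (N.le_add_right N) hN hδ)
    _ = δ * ∑ i ∈ Finset.range (N + N), (N : ℝ) / (|(i : ℝ) - N| + 1) * ∫ s, R i s ^ 2 ∂P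
          + (∫ s, ((stopCount Z b (N + N) s : ℝ) - N) ^ 2 ∂P) / (2 * δ * N) := by
        rw [integral_add (HasAllMoments.integrable (by fun_prop))
          (HasAllMoments.integrable (by fun_prop)), integral_const_mul, integral_div,
          integral_finsetSum _ fun i _ => HasAllMoments.integrable (by fun_prop)]
        simp only [integral_const_mul]
    _ ≤ δ * (C * (1 + Real.log (N + N : ℕ))) + K * (N + N : ℕ) / (2 * δ * N) := by
        gcongr
        exact hweighted N
    _ = η * Real.log (N + N : ℕ) + (η + K / δ) := by
        rw [hδdef]
        push_cast
        field_simp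
        ring

theorem exists_abs_integral_stopCount_sub_le (H : IsPerturbedWalk Z D R I F P)
    {η : ℝ} (hη : 0 < η) :
    ∃ K, ∀ (b : ℝ) (N : ℕ), 0 < b → 1 ≤ N → b ≤ I * N → |b - I * N| ≤ I →
      |I * (∫ s, (stopCount Z b (N + N) s : ℝ) ∂P) - b - ∑ i ∈ Finset.range N, ∫ s, R i s ∂P|
        ≤ η * Real.log (N + N : ℕ) + K := by
  obtain ⟨K₁, hrem⟩ := H.exists_abs_integral_sum_range_stopCount_rem_sub_le (half_pos hη)
  obtain ⟨K₂, hover⟩ := H.hasLogLittleOMax (η / 2) (half_pos hη)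
  obtain ⟨K₃, hunder⟩ := H.exists_le_integral_sum_range_stopCount
  refine ⟨K₁ + |K₂| + |K₃| + |I|, fun b N hb hN hbN hround => ?_⟩
  have hm : 1 ≤ N + N := by omega
  obtain ⟨B, hB, hZB, hBK⟩ := hover (N + N) hm
  have hupper := H.integral_sum_range_stopCount_le hb hm hB
    fun i hi s => (le_abs_self _).trans (hZB i hi s)
  have hlower := hunder b (N + N) hb hm (by push_cast; linarith)
  have hwald := H.integral_sum_range_stopCount_eq hb hm
  have hrem := abs_le.1 (hrem b N hb hN hround)
  have hlog : 0 ≤ η / 2 * Real.log (N + N : ℕ) :=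
    mul_nonneg (half_pos hη).le (Real.log_natCast_nonneg _)
  rw [abs_le]
  constructor <;>
    linarith [le_abs_self K₂, le_abs_self K₃, abs_nonneg K₂, abs_nonneg K₃, le_abs_self I,
      neg_abs_le I]

theorem real_belowUntil_le {b : ℝ} {i : ℕ} (hbi : 2 * b ≤ I * i) :
    P.real (belowUntil Z b i) ≤ P.real {s | ∑ j ∈ Finset.range i, Z j s ≤ I * i / 2} :=
  measureReal_mono fun s hs => (hs i le_rfl).le.trans (by linarith)

theorem real_belowUntil_add_le (H : IsPerturbedWalk Z D R I F P) {b : ℝ} {m : ℕ}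
    (hbm : 2 * b ≤ I * m) (i : ℕ) : P.real (belowUntil Z b (i + m))
      ≤ P.real {s | ∑ j ∈ Finset.range (i + m), Z j s ≤ I * (i + m : ℕ) / 2} :=
  real_belowUntil_le (hbm.trans
    (mul_le_mul_of_nonneg_left (by exact_mod_cast m.le_add_left i) H.drift_pos.le))

theorem summable_real_belowUntil (H : IsPerturbedWalk Z D R I F P) (b : ℝ) :
    Summable fun i => P.real (belowUntil Z b i) := by
  obtain ⟨m, hm⟩ := exists_nat_ge (2 * b / I)
  rw [div_le_iff₀' H.drift_pos] at hm
  have hshift := (summable_nat_add_iff m).2 H.summable_real_sum_range_le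
  rw [← summable_nat_add_iff m]
  exact hshift.of_nonneg_of_le (fun _ => measureReal_nonneg) (H.real_belowUntil_add_le hm)

theorem exists_abs_tsum_real_belowUntil_sub_integral_stopCount_le
    (H : IsPerturbedWalk Z D R I F P) : ∃ K, ∀ (b : ℝ) (m : ℕ), 2 * b ≤ I * m →
      |∑' i, P.real (belowUntil Z b i) - ∫ s, (stopCount Z b m s : ℝ) ∂P| ≤ K := by
  set f : ℕ → ℝ := fun n => P.real {s | ∑ i ∈ Finset.range n, Z i s ≤ I * n / 2}
  have hf : Summable f := H.summable_real_sum_range_le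
  refine ⟨∑' n, f n, fun b m hbm => ?_⟩
  rw [integral_natCast_stopCount H.measurable,
    ← (H.summable_real_belowUntil b).sum_add_tsum_nat_add m, add_sub_cancel_left,
    abs_of_nonneg (tsum_nonneg fun _ => measureReal_nonneg)]
  have hbelow := (summable_nat_add_iff m).2 (H.summable_real_belowUntil b)
  calc ∑' i, P.real (belowUntil Z b (i + m)) ≤ ∑' i, f (i + m) :=
        hbelow.tsum_le_tsum (H.real_belowUntil_add_le hbm) ((summable_nat_add_iff m).2 hf)
    _ ≤ ∑' n, f n := by
        rw [← hf.sum_add_tsum_nat_add m]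
        exact le_add_of_nonneg_left (Finset.sum_nonneg fun _ _ => measureReal_nonneg)

theorem exists_abs_tsum_real_belowUntil_sub_le (H : IsPerturbedWalk Z D R I F P) {η : ℝ}
    (hη : 0 < η) : ∃ K, ∀ b : ℝ, 0 < b →
      |I * (∑' i, P.real (belowUntil Z b i)) - b
          - ∑ i ∈ Finset.range ⌈b / I⌉₊, ∫ s, R i s ∂P|
        ≤ η * Real.log (⌈b / I⌉₊ + ⌈b / I⌉₊ : ℕ) + K := by
  have hI := H.drift_pos
  obtain ⟨K, hK⟩ := H.exists_abs_integral_stopCount_sub_le hη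
  obtain ⟨K', hK'⟩ := H.exists_abs_tsum_real_belowUntil_sub_integral_stopCount_le
  refine ⟨K + I * K', fun b hb => ?_⟩
  set N := ⌈b / I⌉₊
  have hbN : b ≤ I * N := (div_le_iff₀' hI).1 (Nat.le_ceil (b / I))
  have hround : |b - I * N| ≤ I := by
    have hceil : I * (N : ℝ) < I * (b / I + 1) :=
      mul_lt_mul_of_pos_left (Nat.ceil_lt_add_one (by positivity)) hI
    rw [mul_add, mul_div_cancel₀ b hI.ne'] at hceil
    rw [abs_le]
    constructor <;> linarith
  have htrunc := hK b N hb (Nat.one_le_ceil_iff.2 (by positivity)) hbN hround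
  have htail := hK' b (N + N) (by push_cast; linarith)
  rw [abs_le] at htrunc htail ⊢
  constructor <;> nlinarith

end IsPerturbedWalk

section GaussianNoise

variable {Ω : Type*} {mΩ : MeasurableSpace Ω} {P : Measure Ω}

theorem hasAllMoments_of_hasLaw_gaussianReal {f : Ω → ℝ} {m : ℝ} {v : NNReal}
    (hf : HasLaw f (gaussianReal m v) P) : HasAllMoments f P := fun q => by
  have h : MemLp id q (P.map f) := hf.map_eq ▸ memLp_id_gaussianReal q
  exact (memLp_map_measure_iff aestronglyMeasurable_id hf.aemeasurable).1 h

theorem lpNorm_eq_of_hasLaw {f : Ω → ℝ} {ν : Measure ℝ} (hf : HasLaw f ν P) (q : ℝ≥0∞) :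
    lpNorm f q P = lpNorm id q ν := by
  rw [← toReal_eLpNorm hf.aemeasurable.aestronglyMeasurable,
    ← toReal_eLpNorm aestronglyMeasurable_id, ← hf.map_eq,
    eLpNorm_map_measure aestronglyMeasurable_id hf.aemeasurable, Function.id_comp]

theorem lpNorm_of_hasLaw_gaussianReal {f : Ω → ℝ} {v : NNReal}
    (hf : HasLaw f (gaussianReal 0 v) P) (q : ℝ≥0∞) :
    lpNorm f q P = √v * lpNorm id q (gaussianReal 0 1) := by
  have hscale : HasLaw (√(v : ℝ) • id) (gaussianReal 0 v) (gaussianReal 0 1) := by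
    have hvar : NNReal.mk (√v ^ 2) (sq_nonneg _) * 1 = v := NNReal.eq (by simp)
    have h := gaussianReal_const_mul (HasLaw.id (μ := gaussianReal 0 1)) √v
    rwa [mul_zero, hvar] at h
  rw [lpNorm_eq_of_hasLaw hf, ← lpNorm_eq_of_hasLaw hscale, lpNorm_const_smul, coe_nnnorm,
    Real.norm_of_nonneg (Real.sqrt_nonneg _)]

theorem isLpBigO_of_hasLaw_gaussianReal {ι : Type*} {f : ι → Ω → ℝ} {v : ι → NNReal}
    (hf : ∀ i, HasLaw (f i) (gaussianReal 0 (v i)) P) :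
    IsLpBigO f (fun i => √(v i)) P where
  hasAllMoments i := hasAllMoments_of_hasLaw_gaussianReal (hf i)
  exists_lpNorm_le q _ := ⟨lpNorm id q (gaussianReal 0 1), fun i =>
    ((lpNorm_of_hasLaw_gaussianReal (hf i) q).trans (mul_comm _ _)).le⟩

theorem integral_of_hasLaw_gaussianReal {f : Ω → ℝ} {m : ℝ} {v : NNReal}
    (hf : HasLaw f (gaussianReal m v) P) : ∫ s, f s ∂P = m := by
  rw [hf.integral_eq, integral_id_gaussianReal]

theorem integral_sq_of_hasLaw_gaussianReal {f : Ω → ℝ} {v : NNReal}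
    (hf : HasLaw f (gaussianReal 0 v) P) : ∫ s, f s ^ 2 ∂P = v := by
  have h := hf.variance_eq
  rwa [variance_of_integral_eq_zero hf.aemeasurable (integral_of_hasLaw_gaussianReal hf),
    variance_id_gaussianReal] at h

theorem hasLogLittleOMax_of_hasLaw_gaussianReal [IsProbabilityMeasure P] {f : ℕ → Ω → ℝ} {m : ℝ}
    {v : NNReal} (hf : ∀ i, HasLaw (f i) (gaussianReal m v) P) : HasLogLittleOMax f P := by
  have hint (t : ℝ) : Integrable (fun x => Real.exp (t * |x|)) (gaussianReal m v) :=
    integrable_exp_mul_abs (integrable_exp_mul_gaussianReal t)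
      (integrable_exp_mul_gaussianReal (-t))
  refine .of_integral_exp_le (fun t i => ?_)
    fun t => ⟨∫ x, Real.exp (t * |x|) ∂gaussianReal m v, fun i => ?_⟩
  · have h : Integrable (fun x => Real.exp (t * |x|)) (P.map (f i)) := (hf i).map_eq ▸ hint t
    exact h.comp_aemeasurable (hf i).aemeasurable
  · exact ((hf i).integral_comp (hint t).aestronglyMeasurable).le

/-- Standard Gaussian white noise driven by the filtration `F`: `ξ i` is revealed at time `i + 1`
and is independent of what is known at time `i`. -/
structure IsGaussianNoise (ξ : ℕ → Ω → ℝ) (F : Filtration ℕ mΩ) (P : Measure Ω) : Prop where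
  measurable (i : ℕ) : Measurable[F (i + 1)] (ξ i)
  indep (i : ℕ) : Indep (F i) (MeasurableSpace.comap (ξ i) inferInstance) P
  hasLaw (i : ℕ) : HasLaw (ξ i) (gaussianReal 0 1) P

/-- The average of the first `n` terms of the sequence `ξ`; it is `0` for `n = 0`. -/
noncomputable def runningAvg (ξ : ℕ → Ω → ℝ) (n : ℕ) (s : Ω) : ℝ :=
  (∑ i ∈ Finset.range n, ξ i s) / n

namespace IsGaussianNoise

variable {F : Filtration ℕ mΩ} {ξ : ℕ → Ω → ℝ}

theorem hasAllMoments (H : IsGaussianNoise ξ F P) (i : ℕ) : HasAllMoments (ξ i) P :=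
  hasAllMoments_of_hasLaw_gaussianReal (H.hasLaw i)

theorem isLpBigO (H : IsGaussianNoise ξ F P) : IsLpBigO ξ 1 P := by
  simpa [Pi.one_def] using isLpBigO_of_hasLaw_gaussianReal H.hasLaw

theorem isMartingaleDifference_mul [IsProbabilityMeasure P] (H : IsGaussianNoise ξ F P)
    {g : ℕ → Ω → ℝ} (hg : ∀ i, Measurable[F i] (g i)) (hgm : ∀ i, HasAllMoments (g i) P) :
    IsMartingaleDifference (fun i s => g i s * ξ i s) F P where
  measurable i := ((hg i).mono (F.mono i.le_succ) le_rfl).mul (H.measurable i)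
  hasAllMoments i := (hgm i).mul (H.hasAllMoments i)
  condExp_eq_zero i := by
    have hξ : Measurable (ξ i) := (H.measurable i).mono (F.le _) le_rfl
    have hpull : P[g i * ξ i|F i] =ᵐ[P] g i * P[ξ i|F i] :=
      condExp_mul_of_stronglyMeasurable_left (hg i).stronglyMeasurable
        ((hgm i).mul (H.hasAllMoments i)).integrable (H.hasAllMoments i).integrable
    have hzero : P[ξ i|F i] =ᵐ[P] fun _ => ∫ s, ξ i s ∂P :=
      condExp_indep_eq hξ.comap_le (F.le i) (comap_measurable (ξ i)).stronglyMeasurable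
        (H.indep i).symm
    refine hpull.trans ?_
    filter_upwards [hzero] with s hs
    simp [hs, integral_of_hasLaw_gaussianReal (H.hasLaw i)]

theorem measurable_sum_range (H : IsGaussianNoise ξ F P) (n : ℕ) :
    Measurable[F n] fun s => ∑ i ∈ Finset.range n, ξ i s :=
  Finset.measurable_fun_sum _ fun i hi =>
    (H.measurable i).mono (F.mono (Finset.mem_range.1 hi)) le_rfl

theorem measurable_runningAvg (H : IsGaussianNoise ξ F P) (n : ℕ) :
    Measurable[F n] (runningAvg ξ n) :=
  (H.measurable_sum_range n).div_const _

theorem hasLaw_sum_range [IsProbabilityMeasure P] (H : IsGaussianNoise ξ F P) (n : ℕ) :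
    HasLaw (fun s => ∑ i ∈ Finset.range n, ξ i s) (gaussianReal 0 n) P := by
  induction n with
  | zero => exact ⟨by simp, by simp⟩
  | succ n ih =>
    have hind : IndepFun (fun s => ∑ i ∈ Finset.range n, ξ i s) (ξ n) P :=
      indep_of_indep_of_le_left (H.indep n) (H.measurable_sum_range n).comap_le
    simp only [Finset.sum_range_succ]
    refine ⟨ih.aemeasurable.add (H.hasLaw n).aemeasurable, ?_⟩
    rw [Nat.cast_succ, ← zero_add (0 : ℝ)]
    exact gaussianReal_add_gaussianReal_of_indepFun hind ih.map_eq (H.hasLaw n).map_eq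

theorem hasLaw_runningAvg [IsProbabilityMeasure P] (H : IsGaussianNoise ξ F P) (n : ℕ) :
    HasLaw (runningAvg ξ n) (gaussianReal 0 (n : NNReal)⁻¹) P := by
  have hvar : (n : NNReal) / .mk ((n : ℝ) ^ 2) (sq_nonneg _) = (n : NNReal)⁻¹ :=
    NNReal.eq (by simp [sq, div_self_mul_self'])
  have h := gaussianReal_div_const (H.hasLaw_sum_range n) n
  rwa [zero_div, hvar] at h

theorem integral_runningAvg [IsProbabilityMeasure P] (H : IsGaussianNoise ξ F P) (n : ℕ) :
    ∫ s, runningAvg ξ n s ∂P = 0 :=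
  integral_of_hasLaw_gaussianReal (H.hasLaw_runningAvg n)

theorem integral_runningAvg_sq [IsProbabilityMeasure P] (H : IsGaussianNoise ξ F P) (n : ℕ) :
    ∫ s, runningAvg ξ n s ^ 2 ∂P = (n : ℝ)⁻¹ := by
  simpa using integral_sq_of_hasLaw_gaussianReal (H.hasLaw_runningAvg n)

theorem isLpBigO_runningAvg [IsProbabilityMeasure P] (H : IsGaussianNoise ξ F P) :
    IsLpBigO (runningAvg ξ) (fun n => (√((n : ℝ) + 1))⁻¹) P := by
  have hrate (n : ℕ) : √((n : ℝ)⁻¹) ≤ √2 * (√((n : ℝ) + 1))⁻¹ := by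
    rcases n.eq_zero_or_pos with rfl | hn
    · simp
    · have hn1 : (1 : ℝ) ≤ n := by exact_mod_cast hn
      rw [← Real.sqrt_inv, ← Real.sqrt_mul zero_le_two]
      refine Real.sqrt_le_sqrt ?_
      rw [inv_le_iff_one_le_mul₀ (by positivity)]
      field_simp
      linarith
  have h := isLpBigO_of_hasLaw_gaussianReal H.hasLaw_runningAvg
  exact h.mono (fun n => Real.sqrt_nonneg _) fun n => by simpa using hrate n

end IsGaussianNoise

end GaussianNoise

section PlugInLikelihoodRatio

variable {Ω : Type*} {κ : Type*} [Fintype κ] {θ μ : κ → ℝ} {c : ℝ}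

/-- The plug-in estimate used for the observation number `i + 1` of one stream, in terms of the
noise `ξ` of that stream: it fluctuates around its limit `θ`, except that the first one is `0`. -/
noncomputable def plugInMean (θ c : ℝ) (ξ : ℕ → Ω → ℝ) (i : ℕ) (s : Ω) : ℝ :=
  if i = 0 then 0 else θ + c * runningAvg ξ i s

/-- The contribution of the observations `μ k + ξ k i` number `i + 1` of all streams to the
logarithm of the plug-in likelihood ratio, when the estimate in stream `k` has limit `θ k`. -/
noncomputable def logLRIncr (θ μ : κ → ℝ) (c : ℝ) (ξ : κ → ℕ → Ω → ℝ) (i : ℕ) (s : Ω) : ℝ :=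
  ∑ k, (plugInMean (θ k) c (ξ k) i s * (μ k + ξ k i s) - plugInMean (θ k) c (ξ k) i s ^ 2 / 2)

/-- The martingale difference part of `logLRIncr`. -/
noncomputable def logLRMart (θ : κ → ℝ) (c : ℝ) (ξ : κ → ℕ → Ω → ℝ) (i : ℕ) (s : Ω) : ℝ :=
  ∑ k, plugInMean (θ k) c (ξ k) i s * ξ k i s

/-- The loss of information in `logLRIncr` caused by plugging in the estimates instead of their
limits. -/
noncomputable def logLRLoss (θ μ : κ → ℝ) (c : ℝ) (ξ : κ → ℕ → Ω → ℝ) (i : ℕ) (s : Ω) : ℝ :=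
  ∑ k, (c * (θ k - μ k) * runningAvg (ξ k) i s + c ^ 2 / 2 * runningAvg (ξ k) i s ^ 2)

theorem plugInMean_eq (θ c : ℝ) (ξ : ℕ → Ω → ℝ) (i : ℕ) (s : Ω) :
    plugInMean θ c ξ i s = (if i = 0 then 0 else θ) + c * runningAvg ξ i s := by
  rcases i with _ | i <;> simp [plugInMean, runningAvg]

theorem logLRIncr_eq (θ μ : κ → ℝ) (c : ℝ) (ξ : κ → ℕ → Ω → ℝ) (i : ℕ) (s : Ω) :
    logLRIncr θ μ c ξ i s = (if i = 0 then 0 else ∑ k, (θ k * μ k - θ k ^ 2 / 2))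
      + logLRMart θ c ξ i s - logLRLoss θ μ c ξ i s := by
  rcases i with _ | i
  · simp [logLRIncr, logLRMart, logLRLoss, plugInMean, runningAvg]
  · simp only [logLRIncr, logLRMart, logLRLoss, plugInMean, Nat.succ_ne_zero, if_false,
      ← Finset.sum_add_distrib, ← Finset.sum_sub_distrib]
    exact Finset.sum_congr rfl fun k _ => by ring

variable {mΩ : MeasurableSpace Ω} {P : Measure Ω} {F : Filtration ℕ mΩ}

namespace IsGaussianNoise

variable {ξ : ℕ → Ω → ℝ}

theorem measurable_plugInMean (H : IsGaussianNoise ξ F P) (θ c : ℝ) (i : ℕ) :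
    Measurable[F i] (plugInMean θ c ξ i) := by
  rw [funext (plugInMean_eq θ c ξ i)]
  exact ((H.measurable_runningAvg i).const_mul c).const_add _

variable [IsProbabilityMeasure P]

theorem isLpBigO_plugInMean (H : IsGaussianNoise ξ F P) (θ c : ℝ) :
    IsLpBigO (plugInMean θ c ξ) 1 P := by
  have havg : IsLpBigO (runningAvg ξ) 1 P :=
    H.isLpBigO_runningAvg.mono (A := 1) (fun i => by positivity) fun i => by
      simpa using inv_le_one_of_one_le₀ (Real.one_le_sqrt.2 (by simp))
  rw [funext₂ (plugInMean_eq θ c ξ)]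
  exact (IsLpBigO.of_abs_le (abs_ite_eq_zero_le θ)).add (havg.const_mul c)

theorem hasLogLittleOMax_plugInMean_mul (H : IsGaussianNoise ξ F P) (θ c : ℝ) :
    HasLogLittleOMax (fun i s => plugInMean θ c ξ i s * ξ i s) P := by
  have hmain : HasLogLittleOMax (fun i s => (if i = 0 then 0 else θ) * ξ i s) P :=
    ((hasLogLittleOMax_of_hasLaw_gaussianReal H.hasLaw).const_mul θ).mono fun i s => by
      rw [abs_mul, abs_mul]
      exact mul_le_mul_of_nonneg_right (abs_ite_eq_zero_le θ i) (abs_nonneg _)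
  have hfluct : HasLogLittleOMax (fun i s => c * (runningAvg ξ i s * ξ i s)) P := by
    have h := H.isLpBigO_runningAvg.mul H.isLpBigO
    rw [mul_one] at h
    exact h.hasLogLittleOMax.const_mul c
  simpa only [plugInMean_eq, add_mul, mul_assoc] using hmain.add hfluct

theorem isLpBigO_runningAvg_sq (H : IsGaussianNoise ξ F P) :
    IsLpBigO (fun i s => runningAvg ξ i s ^ 2) (fun i => ((i : ℝ) + 1)⁻¹) P := by
  have h := H.isLpBigO_runningAvg.mul H.isLpBigO_runningAvg
  convert h using 1
  · simp only [sq]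
  · ext i
    rw [Pi.mul_apply, ← mul_inv, Real.mul_self_sqrt (by positivity)]

end IsGaussianNoise

variable [IsProbabilityMeasure P] {ξ : κ → ℕ → Ω → ℝ}

theorem isLpBigO_logLRLoss (H : ∀ k, IsGaussianNoise (ξ k) F P) (θ μ : κ → ℝ) (c : ℝ) :
    IsLpBigO (logLRLoss θ μ c ξ) (fun i => (√((i : ℝ) + 1))⁻¹) P := by
  have hrate (i : ℕ) : ((i : ℝ) + 1)⁻¹ ≤ (√((i : ℝ) + 1))⁻¹ :=
    inv_anti₀ (by positivity) (Real.sqrt_le_self_iff.2 (.inr (by simp)))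
  exact .sum _ fun k _ => ((H k).isLpBigO_runningAvg.const_mul _).add
    (((H k).isLpBigO_runningAvg_sq.mono (A := 1) (fun i => by positivity)
      (by simpa using hrate)).const_mul _)

theorem integral_logLRLoss (H : ∀ k, IsGaussianNoise (ξ k) F P) (θ μ : κ → ℝ) (c : ℝ) (i : ℕ) :
    ∫ s, logLRLoss θ μ c ξ i s ∂P = Fintype.card κ * c ^ 2 / 2 * (i : ℝ)⁻¹ := by
  have havg (k : κ) := (H k).isLpBigO_runningAvg.hasAllMoments i
  have hterm (k : κ) : ∫ s, (c * (θ k - μ k) * runningAvg (ξ k) i s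
      + c ^ 2 / 2 * runningAvg (ξ k) i s ^ 2) ∂P = c ^ 2 / 2 * (i : ℝ)⁻¹ := by
    rw [integral_add (HasAllMoments.integrable (by fun_prop))
      (HasAllMoments.integrable (by fun_prop)), integral_const_mul, integral_const_mul,
      (H k).integral_runningAvg, (H k).integral_runningAvg_sq, mul_zero, zero_add]
  simp only [logLRLoss]
  rw [integral_finsetSum _ fun k _ => HasAllMoments.integrable (by fun_prop)]
  simp only [hterm, Finset.sum_const, Finset.card_univ, nsmul_eq_mul]
  ring

theorem isPerturbedWalk_logLRIncr (H : ∀ k, IsGaussianNoise (ξ k) F P)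
    (hI : 0 < ∑ k, (θ k * μ k - θ k ^ 2 / 2)) :
    IsPerturbedWalk (logLRIncr θ μ c ξ) (logLRMart θ c ξ) (logLRLoss θ μ c ξ)
      (∑ k, (θ k * μ k - θ k ^ 2 / 2)) F P where
  drift_pos := hI
  eq_add_sub := logLRIncr_eq θ μ c ξ
  isMartingaleDifference := .sum _ fun k _ => (H k).isMartingaleDifference_mul
    ((H k).measurable_plugInMean (θ k) c) ((H k).isLpBigO_plugInMean (θ k) c).hasAllMoments
  isLpBigO_noise := by
    have h (k : κ) := ((H k).isLpBigO_plugInMean (θ k) c).mul (H k).isLpBigO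
    rw [mul_one] at h
    exact .sum _ fun k _ => h k
  hasLogLittleOMax_noise := .sum _ fun k _ => (H k).hasLogLittleOMax_plugInMean_mul (θ k) c
  measurable_rem i := by
    have havg (k : κ) : Measurable[F (i + 1)] (runningAvg (ξ k) i) :=
      ((H k).measurable_runningAvg i).mono (F.mono i.le_succ) le_rfl
    exact Finset.measurable_fun_sum _ fun k _ =>
      ((havg k).const_mul _).add (((havg k).pow_const 2).const_mul _)
  isLpBigO_rem := isLpBigO_logLRLoss H θ μ c

end PlugInLikelihoodRatio

section ExpectedPassageTime

theorem abs_sum_inv_sub_log_le {x : ℝ} (hx : 1 ≤ x) :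
    |∑ i ∈ Finset.range ⌈x⌉₊, (i : ℝ)⁻¹ - Real.log x| ≤ 1 := by
  have hx0 : 0 < x := one_pos.trans_le hx
  obtain ⟨n, hn⟩ : ∃ n, ⌈x⌉₊ = n + 1 := Nat.exists_eq_succ_of_ne_zero (Nat.ceil_pos.2 hx0).ne'
  have hlt : (n : ℝ) < x := Nat.lt_ceil.1 (by omega)
  have hle : x ≤ (n + 1 : ℕ) := Nat.ceil_le.1 hn.le
  have hlog : Real.log x ≤ ∑ i ∈ Finset.range n, ((i : ℝ) + 1)⁻¹ :=
    (Real.log_le_log hx0 hle).trans (by simpa [harmonic] using log_add_one_le_harmonic n)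
  have hlogn : Real.log n ≤ Real.log x := by
    rcases n.eq_zero_or_pos with rfl | hpos
    · simpa using Real.log_nonneg hx
    · exact Real.log_le_log (by exact_mod_cast hpos) hlt.le
  rw [hn, Finset.sum_range_succ', Nat.cast_zero, inv_zero, add_zero, abs_le]
  push_cast
  constructor <;> linarith [sum_inv_succ_le n]

theorem log_ceil_add_ceil_le {x : ℝ} (hx : 1 ≤ x) :
    Real.log (⌈x⌉₊ + ⌈x⌉₊ : ℕ) ≤ Real.log 4 + Real.log x := by
  have hx0 : 0 < x := one_pos.trans_le hx
  have hceil : (⌈x⌉₊ : ℝ) < x + 1 := Nat.ceil_lt_add_one hx0.le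
  have : 0 < ⌈x⌉₊ := Nat.ceil_pos.2 hx0
  rw [← Real.log_mul four_ne_zero hx0.ne']
  refine Real.log_le_log (by positivity) ?_
  push_cast
  linarith

theorem isLittleO_log_of_forall_abs_le {f : ℝ → ℝ}
    (h : ∀ η > 0, ∃ K, ∀ᶠ b in atTop, |f b| ≤ η * Real.log b + K) :
    f =o[atTop] Real.log := by
  rw [isLittleO_iff]
  intro ε hε
  obtain ⟨K, hK⟩ := h (ε / 2) (by positivity)
  filter_upwards [hK, Real.tendsto_log_atTop.eventually_ge_atTop (K / (ε / 2)),
    eventually_ge_atTop 1] with b hfb hlog hb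
  rw [div_le_iff₀ (by positivity)] at hlog
  rw [Real.norm_eq_abs, Real.norm_of_nonneg (Real.log_nonneg hb)]
  linarith

variable {Ω : Type*} {mΩ : MeasurableSpace Ω} {P : Measure Ω} {F : Filtration ℕ mΩ}

theorem IsPerturbedWalk.isLittleO_tsum_real_belowUntil [IsProbabilityMeasure P]
    {Z D R : ℕ → Ω → ℝ} {I A : ℝ} (H : IsPerturbedWalk Z D R I F P)
    (hR : ∀ i : ℕ, ∫ s, R i s ∂P = A * (i : ℝ)⁻¹) :
    (fun b => ∑' i, P.real (belowUntil Z b i) - (b + A * Real.log b - A * Real.log I) / I)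
      =o[atTop] Real.log := by
  have hI := H.drift_pos
  suffices h : (fun b => I * (∑' i, P.real (belowUntil Z b i)) - b - A * Real.log (b / I))
      =o[atTop] Real.log by
    refine (h.const_mul_left I⁻¹).congr' ?_ .rfl
    filter_upwards [eventually_gt_atTop 0] with b hb
    rw [Real.log_div hb.ne' hI.ne']
    field_simp
    ring
  refine isLittleO_log_of_forall_abs_le fun η hη => ?_
  obtain ⟨K, hK⟩ := H.exists_abs_tsum_real_belowUntil_sub_le hη
  refine ⟨η * (Real.log 4 - Real.log I) + K + |A|, ?_⟩
  filter_upwards [eventually_ge_atTop I] with b hb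
  have hb0 : 0 < b := hI.trans_le hb
  have hx : 1 ≤ b / I := (one_le_div hI).2 hb
  have hsum := hK b hb0
  simp only [hR, ← Finset.mul_sum] at hsum
  have hharm : |A * (∑ i ∈ Finset.range ⌈b / I⌉₊, (i : ℝ)⁻¹ - Real.log (b / I))| ≤ |A| := by
    rw [abs_mul]
    exact mul_le_of_le_one_right (abs_nonneg A) (abs_sum_inv_sub_log_le hx)
  have hlog := mul_le_mul_of_nonneg_left (log_ceil_add_ceil_le hx) hη.le
  rw [Real.log_div hb0.ne' hI.ne'] at hlog
  calc |I * (∑' i, P.real (belowUntil Z b i)) - b - A * Real.log (b / I)|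
    _ ≤ |I * (∑' i, P.real (belowUntil Z b i)) - b - A * ∑ i ∈ Finset.range ⌈b / I⌉₊, (i : ℝ)⁻¹|
        + |A * (∑ i ∈ Finset.range ⌈b / I⌉₊, (i : ℝ)⁻¹ - Real.log (b / I))| :=
      (congrArg abs (by ring)).trans_le (abs_add_le _ _)
    _ ≤ η * Real.log b + (η * (Real.log 4 - Real.log I) + K + |A|) := by linarith

theorem toENNReal_eq_tsum_indicator (t : ℕ∞) :
    (t : ℝ≥0∞) = ∑' i : ℕ, {n : ℕ | (n : ℕ∞) < t}.indicator 1 i := by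
  induction t using ENat.recTopCoe with
  | top => simp
  | coe n => simp [← tsum_subtype]

theorem lintegral_toENNReal_eq_tsum {t : Ω → ℕ∞}
    (ht : ∀ i : ℕ, MeasurableSet {s | (i : ℕ∞) < t s}) :
    ∫⁻ s, (t s : ℝ≥0∞) ∂P = ∑' i : ℕ, P {s | (i : ℕ∞) < t s} := by
  have hswap (i : ℕ) (s : Ω) : {n : ℕ | (n : ℕ∞) < t s}.indicator (1 : ℕ → ℝ≥0∞) i
      = {s | (i : ℕ∞) < t s}.indicator 1 s := rfl
  simp only [toENNReal_eq_tsum_indicator, hswap]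
  rw [lintegral_tsum fun i => (measurable_one.indicator (ht i)).aemeasurable]
  exact tsum_congr fun i => lintegral_indicator_one (ht i)

end ExpectedPassageTime

section Observations

theorem sum_Icc_one_eq_sum_range {M : Type*} [AddCommMonoid M] (f : ℕ → M) (n : ℕ) :
    ∑ i ∈ Finset.Icc 1 n, f i = ∑ i ∈ Finset.range n, f (i + 1) := by
  rw [Finset.range_eq_Ico, Finset.sum_Ico_add' f 0 n 1, zero_add, Finset.Ico_add_one_right_eq_Icc]

theorem gaussianPDFReal_div_eq_exp (a b y : ℝ) :
    gaussianPDFReal a 1 y / gaussianPDFReal b 1 y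
      = Real.exp ((a - b) * y - (a ^ 2 - b ^ 2) / 2) := by
  rw [← log_gaussianPDFReal_div, Real.exp_log]
  exact div_pos (gaussianPDFReal_pos _ _ _ one_ne_zero) (gaussianPDFReal_pos _ _ _ one_ne_zero)

theorem infoNumber_shrunkMean_zero_eq_sum {p : ℕ} (c : ℝ) (w μ : Fin p → ℝ) :
    infoNumber (shrunkMean c w μ) 0 μ
      = ∑ k, (shrunkMean c w μ k * μ k - shrunkMean c w μ k ^ 2 / 2) := by
  rw [infoNumber_shrunkMean_zero, Finset.mul_sum, ← Finset.sum_sub_distrib, Finset.mul_sum]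
  refine Finset.sum_congr rfl fun k _ => ?_
  simp only [shrunkMean]
  ring

variable {Ω : Type*} {κ : Type*}

/-- The noise in the observations `X` with means `μ`; observation number `i + 1` has index `i`, as
`X` starts at index `1`. -/
def obsNoise (X : κ → ℕ → Ω → ℝ) (μ : κ → ℝ) (k : κ) (i : ℕ) (s : Ω) : ℝ :=
  X k (i + 1) s - μ k

section Law

variable {mΩ : MeasurableSpace Ω} {X : κ → ℕ → Ω → ℝ}

/-- The filtration whose `n`-th σ-algebra is generated by the observations at times `1, …, n`. -/
def obsFiltration (hmeas : ∀ k ℓ, 1 ≤ ℓ → Measurable (X k ℓ)) : Filtration ℕ mΩ where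
  seq n := ⨆ q ∈ {q : κ × ℕ | q.2 < n}, MeasurableSpace.comap (X q.1 (q.2 + 1)) inferInstance
  mono' _ _ h := biSup_mono fun _ hq => lt_of_lt_of_le hq h
  le' _ := iSup₂_le fun q _ => (hmeas q.1 (q.2 + 1) q.2.succ_pos).comap_le

theorem comap_obs_le_obsFiltration (hmeas : ∀ k ℓ, 1 ≤ ℓ → Measurable (X k ℓ)) (k : κ) (i : ℕ) :
    MeasurableSpace.comap (X k (i + 1)) inferInstance ≤ obsFiltration hmeas (i + 1) :=
  le_biSup (fun q : κ × ℕ => MeasurableSpace.comap (X q.1 (q.2 + 1)) inferInstance)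
    (i := (k, i)) i.lt_succ_self

theorem comap_obsNoise_le (μ : κ → ℝ) (k : κ) (i : ℕ) :
    MeasurableSpace.comap (obsNoise X μ k i) inferInstance
      ≤ MeasurableSpace.comap (X k (i + 1)) inferInstance :=
  ((comap_measurable (X k (i + 1))).sub_const (μ k)).comap_le

theorem isGaussianNoise_obsNoise {P : Measure Ω} {μ : κ → ℝ}
    (hmeas : ∀ k ℓ, 1 ≤ ℓ → Measurable (X k ℓ))
    (hindep : iIndepFun (fun q : κ × ℕ => X q.1 (q.2 + 1)) P)
    (hlaw : ∀ k ℓ, 1 ≤ ℓ → P.map (X k ℓ) = gaussianReal (μ k) 1) (k : κ) :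
    IsGaussianNoise (obsNoise X μ k) (obsFiltration hmeas) P where
  measurable i := measurable_iff_comap_le.2 <|
    (comap_obsNoise_le μ k i).trans (comap_obs_le_obsFiltration hmeas k i)
  indep i := by
    have h := indep_iSup_of_disjoint (fun q => (hmeas q.1 (q.2 + 1) q.2.succ_pos).comap_le)
      hindep.iIndep (S := {q : κ × ℕ | q.2 < i}) (T := {(k, i)}) (by simp)
    rw [iSup_singleton] at h
    exact indep_of_indep_of_le_right h (comap_obsNoise_le μ k i)
  hasLaw i := by
    have hX : HasLaw (X k (i + 1)) (gaussianReal (μ k) 1) P :=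
      ⟨(hmeas k (i + 1) i.succ_pos).aemeasurable, hlaw k (i + 1) i.succ_pos⟩
    have h := gaussianReal_sub_const hX (μ k)
    rwa [sub_self] at h

end Law

variable {p : ℕ} (X : Fin p → ℕ → Ω → ℝ) (c : ℝ) (w μ : Fin p → ℝ)

theorem shrinkEst_succ (k : Fin p) (i : ℕ) (s : Ω) :
    shrinkEst c (w k) (fun ℓ => X k ℓ s) (i + 1)
      = plugInMean (shrunkMean c w μ k) c (obsNoise X μ k) i s := by
  rcases i.eq_zero_or_pos with rfl | hi
  · simp [shrinkEst, plugInMean]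
  · simp only [shrinkEst, plugInMean, hi.ne', (Nat.lt_add_of_pos_left hi).not_ge, if_false,
      shrunkMean, runningAvg, obsNoise, Nat.add_sub_cancel, sum_Icc_one_eq_sum_range,
      Finset.sum_sub_distrib, Finset.sum_const, Finset.card_range, nsmul_eq_mul]
    push_cast
    rw [add_sub_cancel_right]
    field_simp
    ring

theorem plugInLR_eq_exp_sum_logLRIncr (s : Ω) (n : ℕ) :
    plugInLR c w (fun k ℓ => X k ℓ s) n = Real.exp (∑ i ∈ Finset.range n,
      logLRIncr (shrunkMean c w μ) μ c (obsNoise X μ) i s) := by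
  simp only [plugInLR, gaussianPDFReal_div_eq_exp, ← Real.exp_sum, sum_Icc_one_eq_sum_range,
    shrinkEst_succ X c w μ, logLRIncr, obsNoise, add_sub_cancel, sub_zero, zero_pow two_ne_zero]

theorem lt_stopTime_iff {b : ℝ} (hb : 0 < b) (i : ℕ) (s : Ω) :
    (i : ℕ∞) < stopTime c w b (fun k ℓ => X k ℓ s) ↔
      s ∈ belowUntil (logLRIncr (shrunkMean c w μ) μ c (obsNoise X μ)) b i := by
  rw [← ENat.add_one_le_iff (ENat.natCast_ne_top i), stopTime, le_iInf₂_iff]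
  simp only [plugInLR_eq_exp_sum_logLRIncr X c w μ, Real.exp_le_exp, belowUntil,
    Set.mem_ofPred_eq]
  norm_cast
  refine ⟨fun h n hn => ?_, fun h n hn => ?_⟩
  · by_contra! hcross
    rcases n.eq_zero_or_pos with rfl | hpos
    · simp only [Finset.range_zero, Finset.sum_empty] at hcross
      exact hcross.not_gt hb
    · exact (h n ⟨hpos, hcross⟩).not_gt (Nat.lt_succ_of_le hn)
  · by_contra! hlt
    exact (h n (Nat.lt_succ_iff.1 hlt)).not_ge hn.2

variable {X c w μ}

theorem lintegral_stopTime {mΩ : MeasurableSpace Ω} {P : Measure Ω} [IsProbabilityMeasure P]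
    {D R : ℕ → Ω → ℝ} {I : ℝ} {F : Filtration ℕ mΩ}
    (H : IsPerturbedWalk (logLRIncr (shrunkMean c w μ) μ c (obsNoise X μ)) D R I F P)
    {b : ℝ} (hb : 0 < b) :
    ∫⁻ s, (stopTime c w b (fun k ℓ => X k ℓ s) : ℝ≥0∞) ∂P = ENNReal.ofReal
      (∑' i, P.real (belowUntil (logLRIncr (shrunkMean c w μ) μ c (obsNoise X μ)) b i)) := by
  have hset (i : ℕ) : {s | (i : ℕ∞) < stopTime c w b (fun k ℓ => X k ℓ s)}
      = belowUntil (logLRIncr (shrunkMean c w μ) μ c (obsNoise X μ)) b i :=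
    Set.ext (lt_stopTime_iff X c w μ hb i)
  have hbelow (i : ℕ) := F.le i _ (measurableSet_belowUntil H.measurable b i)
  rw [lintegral_toENNReal_eq_tsum fun i => (hset i).symm ▸ hbelow i,
    ENNReal.ofReal_tsum_of_nonneg (fun _ => measureReal_nonneg) (H.summable_real_belowUntil b)]
  exact tsum_congr fun i => by rw [hset, ofReal_measureReal]

theorem monotone_stopTime (c : ℝ) (w : Fin p → ℝ) (x : Fin p → ℕ → ℝ) :
    Monotone fun b => stopTime c w b x :=
  fun _ _ hb => le_iInf₂ fun n hn => iInf₂_le n ⟨hn.1, (Real.exp_le_exp.2 hb).trans hn.2⟩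

end Observations

theorem theorem1_general
    {Ω : Type*} [MeasurableSpace Ω] (P : Measure Ω) [IsProbabilityMeasure P]
    (p : ℕ) (c : ℝ) (w μ : Fin p → ℝ)
    (X : Fin p → ℕ → Ω → ℝ)
    (hmeas : ∀ k ℓ, 1 ≤ ℓ → Measurable (X k ℓ))
    (hindep : iIndepFun (fun q : Fin p × ℕ => X q.1 (q.2 + 1)) P)
    (hlaw : ∀ k ℓ, 1 ≤ ℓ → P.map (X k ℓ) = gaussianReal (μ k) 1)
    (hI : 0 < infoNumber (shrunkMean c w μ) 0 μ) :
    (∀ b : ℝ, ∫⁻ s, (stopTime c w b (fun k ℓ => X k ℓ s) : ℝ≥0∞) ∂P ≠ ∞) ∧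
    (fun b : ℝ =>
        (∫⁻ s, (stopTime c w b (fun k ℓ => X k ℓ s) : ℝ≥0∞) ∂P).toReal
          - (b + (p * c ^ 2 / 2) * Real.log b
              - (p * c ^ 2 / 2) * Real.log (infoNumber (shrunkMean c w μ) 0 μ))
            / infoNumber (shrunkMean c w μ) 0 μ)
      =o[atTop] (fun b : ℝ => (p : ℝ) * Real.log b) := by
  rw [infoNumber_shrunkMean_zero_eq_sum] at hI ⊢
  have hnoise := isGaussianNoise_obsNoise hmeas hindep hlaw
  have hwalk := isPerturbedWalk_logLRIncr (c := c) hnoise hI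
  have hmean {b : ℝ} (hb : 0 < b) := lintegral_stopTime hwalk hb
  refine ⟨fun b => ?_, ?_⟩
  · have hfin : ∫⁻ s, (stopTime c w (max b 1) (fun k ℓ => X k ℓ s) : ℝ≥0∞) ∂P ≠ ∞ :=
      hmean (lt_max_of_lt_right one_pos) ▸ ENNReal.ofReal_ne_top
    exact ne_top_of_le_ne_top hfin <| lintegral_mono fun s =>
      ENat.toENNReal_le.2 (monotone_stopTime c w _ (le_max_left b 1))
  · have hp : (p : ℝ) ≠ 0 := by
      intro hp
      obtain rfl := Nat.cast_eq_zero.1 hp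
      simp at hI
    have hexp := hwalk.isLittleO_tsum_real_belowUntil (integral_logLRLoss hnoise _ μ c)
    rw [Fintype.card_fin] at hexp
    refine (hexp.const_mul_right hp).congr' ?_ .rfl
    filter_upwards [eventually_gt_atTop 0] with b hb
    rw [hmean hb, ENNReal.toReal_ofReal (tsum_nonneg fun _ => measureReal_nonneg)]

theorem theorem1
    {Ω : Type*} [MeasurableSpace Ω] (P : Measure Ω) [IsProbabilityMeasure P]
    (p : ℕ) (c : ℝ) (hc : c ∈ Set.Icc (0 : ℝ) 1)
    (w : Fin p → ℝ) (hw : ∀ k, 0 ≤ w k) (hw' : ∃ k, 0 < w k)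
    (μ : Fin p → ℝ)
    -- `X k ℓ` is the observation of stream `k` at time `ℓ = 1, 2, …`
    (X : Fin p → ℕ → Ω → ℝ)
    (hmeas : ∀ k ℓ, 1 ≤ ℓ → Measurable (X k ℓ))
    (hindep : iIndepFun (fun q : Fin p × ℕ => X q.1 (q.2 + 1)) P)
    (hlaw : ∀ k ℓ, 1 ≤ ℓ → P.map (X k ℓ) = gaussianReal (μ k) 1)
    (hI : 0 < infoNumber (shrunkMean c w μ) 0 μ) :
    (∀ b : ℝ, ∫⁻ s, (stopTime c w b (fun k ℓ => X k ℓ s) : ℝ≥0∞) ∂P ≠ ∞) ∧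
    (fun b : ℝ =>
        (∫⁻ s, (stopTime c w b (fun k ℓ => X k ℓ s) : ℝ≥0∞) ∂P).toReal
          - (b + (p * c ^ 2 / 2) * Real.log b
              - (p * c ^ 2 / 2) * Real.log (infoNumber (shrunkMean c w μ) 0 μ))
            / infoNumber (shrunkMean c w μ) 0 μ)
      =o[atTop] (fun b : ℝ => (p : ℝ) * Real.log b) :=
  theorem1_general P p c w μ X hmeas hindep hlaw hI
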